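/- Fix a positive integer $c$, real numbers $\hbar,\mu,\nu$ with $\mu^2+\nu^2\neq 0$, and a real number $\alpha>1$. Write $e(t)=e^{2\pi i t}$. Let $\mathcal A$ be the unital $*$-algebra of smooth functions $\Phi:\mathbb R\times\mathbb T\times\mathbb Z\to\mathbb C$ such that $\Phi(x+k,y,p)=e(ckpy)\,\Phi(x,y,p)$ for all $k\in\mathbb Z$, and such that for every polynomial $P$, all $m,n\ge 0$ and every compact $K\subset\mathbb R\times\mathbb T$ the function $P(p)\,\partial_x^m\partial_y^n\Phi(x,y,p)$ is bounded on $K\times\mathbb Z$; the product and involution are $$(\Phi\star\Psi)(x,y,p)=\sum_{q\in\mathbb Z}\Phi(x-\hbar(q-p)\mu,\,y-\hbar(q-p)\nu,\,q)\,\Psi(x-\hbar q\mu,\,y-\hbar q\nu,\,p-q),\qquad \Phi^*(x,y,p)=\overline{\Phi(x,y,-p)} .$$ Let $d_1f=-\partial_xf$, $d_2f=2\pi i c p x f-\partial_yf$, $d_3f=2\pi i p c\alpha f$, put $\delta_j=i\,d_j$, and let $$\sigma_1=\begin{pmatrix}1&0\\0&-1\end{pmatrix},\quad \sigma_2=\begin{pmatrix}0&-1\\-1&0\end{pmatrix},\quad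 \sigma_3=\begin{pmatrix}0&i\\-i&0\end{pmatrix}.$$ Let $\tau(a)=\int_0^1\int_{\mathbb T}a(x,y,0)\,dy\,dx$, let $\mathcal H=L^2(\mathcal A,\tau)\otimes\mathbb C^2$, on which $\mathcal A$ acts by left multiplication, and let $D=\sum_{j=1}^3\delta_j\otimes\sigma_j$ on the dense domain $\mathcal A\otimes\mathbb C^2\subset\mathcal H$. Every commutator $[D,a]$, $a\in\mathcal A$, extends to a bounded operator on $\mathcal H$; put $\tilde d a=[D,a]$ and let $\Omega^1_D=\{\sum_i a_i[D,b_i] : a_i,b_i\in\mathcal A\}\subset\mathcal B(\mathcal H)$ be the $\mathcal A$-bimodule of one-forms. Let $\mathcal E$ be a finitely generated projective right $\mathcal A$-module with a Hermitian structure, i.e. a positive definite $\mathcal A$-valued inner product with $\langle\xi,\xi'\rangle^*=\langle\xi',\xi\rangle$ and $\langle\xi,\xi'a\rangle=\langle\xi,\xi'\rangle a$, such that $\xi\mapsto\langle\xi,\cdot\rangle$ is a bijection from $\mathcal E$ onto the $\mathcal A$-linear maps $\mathcal E\to\mathcal A$. A compatible connection on $\mathcal E$ is a $\mathbb C$-linear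 map $\widetilde\nabla:\mathcal E\to\mathcal E\otimes_{\mathcal A}\Omega^1_D$ such that, for all $\xi,\eta\in\mathcal E$ and $a\in\mathcal A$, $$\widetilde\nabla(\xi a)=(\widetilde\nabla\xi)a+\xi\otimes\tilde d a,\qquad (\xi,\widetilde\nabla\eta)-(\widetilde\nabla\xi,\eta)=\tilde d\langle\xi,\eta\rangle,$$ where $(\xi,\eta\otimes\omega)=\langle\xi,\eta\rangle\omega$ and $(\xi\otimes\omega,\eta)=\omega^*\langle\xi,\eta\rangle$. **Proposition.** The operators $1\otimes\sigma_1,1\otimes\sigma_2,1\otimes\sigma_3$ belong to $\Omega^1_D$, and $$(\widetilde\nabla_1,\widetilde\nabla_2,\widetilde\nabla_3)\longmapsto\Big(\xi\mapsto\sum_{j=1}^3\widetilde\nabla_j(\xi)\otimes\sigma_j\Big)$$ is a bijection from the set of triples of $\mathbb C$-linear maps $\widetilde\nabla_j:\mathcal E\to\mathcal E$ satisfying, for $j=1,2,3$, all $\xi,\xi'\in\mathcal E$ and all $a\in\mathcal A$, $$\widetilde\nabla_j(\xi a)=\widetilde\nabla_j(\xi)a+\xi\,\delta_j(a),\qquad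 \delta_j(\langle\xi,\xi'\rangle)=\langle\xi,\widetilde\nabla_j\xi'\rangle-\langle\widetilde\nabla_j\xi,\xi'\rangle,$$ onto the set of compatible connections on $\mathcal E$. -/

import Mathlib

open scoped ContDiff TensorProduct

noncomputable section

/-- The data of a spectral triple `(𝒜, ℋ, D)` that enters the calculus of one-forms: a faithful
`*`-representation of `𝒜` by bounded operators on a Hilbert space `ℋ`, and a densely defined
symmetric operator `D`, whose domain is invariant under `𝒜`, such that every commutator `[D, a]`
is bounded.  (`D` may be given on a core; passing to its closure does not change the bounded
operators `[D, a]`.) -/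
structure DiracTriple (A H : Type*) [Ring A] [StarRing A] [Algebra ℂ A]
    [NormedAddCommGroup H] [InnerProductSpace ℂ H] [CompleteSpace H] where
  rep : A →⋆ₐ[ℂ] (H →L[ℂ] H)
  rep_injective : Function.Injective rep
  D : H →ₗ.[ℂ] H
  dense_domain : Dense (D.domain : Set H)
  symmetric : D.IsFormalAdjoint D
  rep_mem_domain : ∀ (a : A), ∀ u ∈ D.domain, rep a u ∈ D.domain
  exists_commutator : ∀ a : A, ∃ T : H →L[ℂ] H, ∀ u : D.domain,
    T u = D ⟨rep a u, rep_mem_domain a u u.2⟩ - rep a (D u)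

namespace DiracTriple

variable {A H : Type*} [Ring A] [StarRing A] [Algebra ℂ A]
  [NormedAddCommGroup H] [InnerProductSpace ℂ H] [CompleteSpace H] (T : DiracTriple A H)

/-- The bounded operator `[D, a]`. -/
def comm (a : A) : H →L[ℂ] H := (T.exists_commutator a).choose

theorem comm_apply (a : A) (u : T.D.domain) :
    T.comm a u = T.D ⟨T.rep a u, T.rep_mem_domain a u u.2⟩ - T.rep a (T.D u) :=
  (T.exists_commutator a).choose_spec u

theorem ext_domain {S S' : H →L[ℂ] H} (hS : ∀ u : T.D.domain, S u = S' u) : S = S' :=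
  ContinuousLinearMap.ext fun x => congrFun (Continuous.ext_on T.dense_domain S.continuous
    S'.continuous fun u hu => hS ⟨u, hu⟩) x

theorem comm_mul (a b : A) : T.comm (a * b) = T.comm a * T.rep b + T.rep a * T.comm b := by
  refine T.ext_domain fun u => ?_
  have h1 := T.comm_apply a ⟨T.rep b u, T.rep_mem_domain b u u.2⟩
  have h2 := T.comm_apply b u
  have h3 := T.comm_apply (a * b) u
  have h4 : T.rep (a * b) = T.rep a * T.rep b := map_mul _ _ _
  have h5 : T.D ⟨T.rep (a * b) u, T.rep_mem_domain (a * b) u u.2⟩ =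
      T.D ⟨T.rep a (T.rep b u), T.rep_mem_domain a _ (T.rep_mem_domain b u u.2)⟩ := by
    congr 1
    exact Subtype.ext (congrArg (fun S : H →L[ℂ] H => S u) h4)
  rw [h5, h4] at h3
  change T.comm (a * b) u = T.comm a (T.rep b u) + T.rep a (T.comm b u)
  rw [h3, h1, h2, map_sub]
  change _ - T.rep a (T.rep b (T.D u)) = _
  abel

/-- The space of one-forms `Ω¹_D(𝒜) = {∑ a [D, b]}`, a subspace of the bounded operators (the
representation being faithful, `Ω¹_D` is the image `π(Ω¹)` of the universal one-forms). -/
def oneForms : Submodule ℂ (H →L[ℂ] H) :=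
  Submodule.span ℂ {S | ∃ a b : A, S = T.rep a * T.comm b}

/-- The differential `a ↦ [D, a]` with values in the one-forms. -/
def diff (a : A) : T.oneForms :=
  ⟨T.comm a, Submodule.subset_span ⟨1, a, by simp⟩⟩

theorem rep_mul_mem (a : A) (S : H →L[ℂ] H) (hS : S ∈ T.oneForms) :
    T.rep a * S ∈ T.oneForms := by
  induction hS using Submodule.span_induction with
  | mem S hS =>
    obtain ⟨x, y, rfl⟩ := hS
    exact Submodule.subset_span ⟨a * x, y, by rw [map_mul, mul_assoc]⟩
  | zero => simp
  | add S S' _ _ h1 h2 => rw [mul_add]; exact add_mem h1 h2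
  | smul r S _ h1 => rw [mul_smul_comm]; exact Submodule.smul_mem _ r h1

theorem mul_rep_mem (a : A) (S : H →L[ℂ] H) (hS : S ∈ T.oneForms) :
    S * T.rep a ∈ T.oneForms := by
  induction hS using Submodule.span_induction with
  | mem S hS =>
    obtain ⟨x, y, rfl⟩ := hS
    have h1 : T.rep x * T.comm y * T.rep a =
        T.rep x * T.comm (y * a) - T.rep (x * y) * T.comm a := by
      rw [comm_mul, map_mul, mul_add, mul_assoc, mul_assoc, add_sub_cancel_right]
    rw [h1]
    exact sub_mem (Submodule.subset_span ⟨_, _, rfl⟩) (Submodule.subset_span ⟨_, _, rfl⟩)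
  | zero => simp
  | add S S' _ _ h1 h2 => rw [add_mul]; exact add_mem h1 h2
  | smul r S _ h1 => rw [smul_mul_assoc]; exact Submodule.smul_mem _ r h1

/-- Left multiplication `θ ↦ a θ` on one-forms. -/
def lmul (a : A) : T.oneForms →ₗ[ℂ] T.oneForms :=
  (LinearMap.mulLeft ℂ (T.rep a)).restrict fun S hS => T.rep_mul_mem a S hS

/-- Right multiplication `θ ↦ θ a` on one-forms. -/
def rmul (a : A) : T.oneForms →ₗ[ℂ] T.oneForms :=
  (LinearMap.mulRight ℂ (T.rep a)).restrict fun S hS => T.mul_rep_mem a S hS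

variable (E : Type*) [AddCommGroup E] [Module ℂ E] [Module Aᵐᵒᵖ E]

/-- The relations `ξ a ⊗ θ = ξ ⊗ a θ`. -/
def balancing : Submodule ℂ (E ⊗[ℂ] T.oneForms) :=
  Submodule.span ℂ {t | ∃ (ξ : E) (a : A) (θ : T.oneForms),
    t = (MulOpposite.op a • ξ) ⊗ₜ[ℂ] θ - ξ ⊗ₜ[ℂ] T.lmul a θ}

/-- The tensor product `ℰ ⊗_𝒜 Ω¹_D` of a right `𝒜`-module with the bimodule of one-forms. -/
abbrev FormTensor : Type _ := (E ⊗[ℂ] T.oneForms) ⧸ T.balancing E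

variable {E}

/-- The map `ξ ↦ ξ ⊗ θ` from `ℰ` to `ℰ ⊗_𝒜 Ω¹_D`. -/
def tensorRight (θ : T.oneForms) : E →ₗ[ℂ] T.FormTensor E :=
  (T.balancing E).mkQ ∘ₗ (TensorProduct.mk ℂ E T.oneForms).flip θ

variable (E) in
/-- The right action `t ↦ t a` of `𝒜` on `ℰ ⊗_𝒜 Ω¹_D`, with `(ξ ⊗ θ) a = ξ ⊗ θ a`. -/
def rightMul (a : A) : T.FormTensor E →ₗ[ℂ] T.FormTensor E :=
  (T.balancing E).mapQ (T.balancing E) (LinearMap.lTensor E (T.rmul a)) (by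
    refine Submodule.span_le.mpr ?_
    rintro _ ⟨ξ, b, θ, rfl⟩
    have h1 : T.rmul a (T.lmul b θ) = T.lmul b (T.rmul a θ) := Subtype.ext (mul_assoc _ _ _)
    refine Submodule.subset_span ⟨ξ, b, T.rmul a θ, ?_⟩
    rw [map_sub, LinearMap.lTensor_tmul, LinearMap.lTensor_tmul, h1])

theorem rightMul_tensorRight (a : A) (θ : T.oneForms) (ξ : E) :
    T.rightMul E a (T.tensorRight θ ξ) = T.tensorRight (T.rmul a θ) ξ := rfl

variable (E) in
/-- A Hermitian structure on a right `𝒜`-module: a positive definite `𝒜`-valued inner product,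
such that `ξ ↦ ⟨ξ, ·⟩` is a bijection of `ℰ` onto the `𝒜`-linear maps `ℰ → 𝒜`. -/
structure HermitianStructure where
  inner : E → E → A
  inner_add_right : ∀ ξ η η', inner ξ (η + η') = inner ξ η + inner ξ η'
  inner_smul_right : ∀ ξ η a, inner ξ (MulOpposite.op a • η) = inner ξ η * a
  star_inner : ∀ ξ η, star (inner ξ η) = inner η ξ
  nonneg : ∀ ξ, (T.rep (inner ξ ξ)).IsPositive
  definite : ∀ ξ, inner ξ ξ = 0 → ξ = 0
  selfDual : ∀ φ : E →ₗ[Aᵐᵒᵖ] A, ∃! ξ : E, ∀ η, φ η = inner ξ η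

namespace HermitianStructure

variable {T} [IsScalarTower ℂ Aᵐᵒᵖ E] (h : T.HermitianStructure E)

theorem inner_complex_smul_right (r : ℂ) (ξ η : E) : h.inner ξ (r • η) = r • h.inner ξ η := by
  have h1 : r • η = MulOpposite.op (r • (1 : A)) • η := by
    rw [MulOpposite.op_smul, MulOpposite.op_one, smul_assoc, one_smul]
  rw [h1, h.inner_smul_right, mul_smul_comm, mul_one]

/-- The pairing `(ξ, η ⊗ θ) = ⟨ξ, η⟩ θ` of `ℰ` with `ℰ ⊗_𝒜 Ω¹_D`. -/
def pairRight (ξ : E) : T.FormTensor E →ₗ[ℂ] (H →L[ℂ] H) :=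
  (T.balancing E).liftQ
    (TensorProduct.lift (LinearMap.mk₂ ℂ (fun η (θ : T.oneForms) => T.rep (h.inner ξ η) * θ.1)
      (fun η η' θ => by rw [h.inner_add_right, map_add, add_mul])
      (fun r η θ => by rw [h.inner_complex_smul_right, map_smul, smul_mul_assoc])
      (fun η θ θ' => mul_add _ _ _)
      (fun r η θ => mul_smul_comm _ _ _)))
    (by
      refine Submodule.span_le.mpr ?_
      rintro _ ⟨η, a, θ, rfl⟩
      simp only [SetLike.mem_coe, LinearMap.mem_ker, map_sub, TensorProduct.lift.tmul,
        LinearMap.mk₂_apply, h.inner_smul_right, map_mul]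
      rw [mul_assoc]
      exact sub_self _)

theorem pairRight_tensorRight (ξ η : E) (θ : T.oneForms) :
    h.pairRight ξ (T.tensorRight θ η) = T.rep (h.inner ξ η) * θ.1 := rfl

/-- The pairing `(ξ ⊗ θ, η) = θ^* ⟨ξ, η⟩` of `ℰ ⊗_𝒜 Ω¹_D` with `ℰ`; it is the adjoint of
`(η, ξ ⊗ θ) = ⟨η, ξ⟩ θ`. -/
def pairLeft (t : T.FormTensor E) (η : E) : H →L[ℂ] H := star (h.pairRight η t)

theorem pairLeft_tensorRight (ξ η : E) (θ : T.oneForms) :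
    h.pairLeft (T.tensorRight θ ξ) η = star θ.1 * T.rep (h.inner ξ η) := by
  rw [pairLeft, pairRight_tensorRight, star_mul, ← map_star, h.star_inner]

/-- Compatible connections `∇ : ℰ → ℰ ⊗_𝒜 Ω¹_D`: the Leibniz rule
`∇(ξ a) = (∇ξ) a + ξ ⊗ da` and the compatibility `(ξ, ∇η) - (∇ξ, η) = d⟨ξ, η⟩`. -/
structure IsCompatibleConnection (nabla : E →ₗ[ℂ] T.FormTensor E) : Prop where
  leibniz : ∀ (ξ : E) (a : A), nabla (MulOpposite.op a • ξ) =
    T.rightMul E a (nabla ξ) + T.tensorRight (T.diff a) ξ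
  compatible : ∀ ξ η : E, h.pairRight ξ (nabla η) - h.pairLeft (nabla ξ) η =
    (T.diff (h.inner ξ η) : H →L[ℂ] H)

end HermitianStructure

end DiracTriple

namespace QHM

/-- `e(t) = exp (2πit)`. -/
def e (t : ℝ) : ℂ := Complex.exp ((2 * Real.pi * t : ℝ) * Complex.I)

theorem e_add (s t : ℝ) : e (s + t) = e s * e t := by
  unfold e
  rw [← Complex.exp_add]
  push_cast
  ring_nf

theorem norm_e (t : ℝ) : ‖e t‖ = 1 := by
  unfold e
  exact Complex.norm_exp_ofReal_mul_I _

theorem e_conj (t : ℝ) : (starRingEnd ℂ) (e t) = e (-t) := by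
  unfold e
  rw [← Complex.exp_conj, map_mul, Complex.conj_ofReal, Complex.conj_I]
  push_cast
  ring_nf

theorem e_contDiff : ContDiff ℝ ∞ e := by
  unfold e
  have h : ContDiff ℝ ∞ (fun t : ℝ => ((2 * Real.pi * t : ℝ) : ℂ)) :=
    Complex.ofRealCLM.contDiff.comp (contDiff_const.mul contDiff_id)
  exact (h.mul contDiff_const).cexp

theorem e_iteratedDeriv (k : ℕ) :
    iteratedDeriv k e = fun t => ((2 * Real.pi : ℝ) * Complex.I) ^ k * e t := by
  induction k with
  | zero => ext t; simp
  | succ k ih =>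
    rw [iteratedDeriv_succ, ih]
    ext t
    have h : HasDerivAt e (((2 * Real.pi : ℝ) * Complex.I) * e t) t := by
      unfold e
      have h1 : HasDerivAt (fun t : ℝ => ((2 * Real.pi * t : ℝ) : ℂ) * Complex.I)
          (((2 * Real.pi : ℝ) : ℂ) * Complex.I) t := by
        have h0 : HasDerivAt (fun t : ℝ => (2 * Real.pi * t : ℝ)) (2 * Real.pi) t := by
          simpa using (hasDerivAt_id t).const_mul (2 * Real.pi)
        exact h0.ofReal_comp.mul_const _
      have h2 := h1.cexp
      rwa [mul_comm (Complex.exp _)] at h2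
    rw [(h.const_mul _).deriv]
    ring

/-- The defining conditions of the space `S^c` of smooth functions on `ℝ × 𝕋 × ℤ`.  A function on
`ℝ × 𝕋 × ℤ` is a family `f p (x, y)`, `p ∈ ℤ`, of functions on the plane which are `1`-periodic in
`y`; the bounds say that every partial derivative in `(x, y)`, multiplied with any power (hence any
polynomial) of `p`, is bounded on `K × ℤ` for every compact `K`. -/
structure IsSmoothSection (c : ℕ) (f : ℤ → ℝ × ℝ → ℂ) : Prop where
  smooth : ∀ p, ContDiff ℝ ∞ (f p)
  periodic : ∀ p x y, f p (x, y + 1) = f p (x, y)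
  quasiperiodic : ∀ (k p : ℤ) (x y : ℝ), f p (x + k, y) = e (c * k * p * y) * f p (x, y)
  decay : ∀ (N k : ℕ) (K : Set (ℝ × ℝ)), IsCompact K →
    ∃ C : ℝ, ∀ p : ℤ, ∀ z ∈ K, |(p : ℝ)| ^ N * ‖iteratedFDeriv ℝ k (f p) z‖ ≤ C

theorem periodic_int {g : ℝ → ℂ} (hg : ∀ y, g (y + 1) = g y) (n : ℤ) (y : ℝ) :
    g (y + n) = g y := by
  have h : Function.Periodic g 1 := hg
  simpa using h.int_mul n y

theorem one_add_pow_le (t : ℝ) (ht : 0 ≤ t) (N : ℕ) : (1 + t) ^ N ≤ 2 ^ N * (1 + t ^ N) := by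
  rcases le_total t 1 with h | h
  · calc (1 + t) ^ N ≤ 2 ^ N := by gcongr; linarith
      _ ≤ 2 ^ N * (1 + t ^ N) := by
        have : 0 ≤ t ^ N := by positivity
        nlinarith [show (0:ℝ) < 2 ^ N by positivity]
  · calc (1 + t) ^ N ≤ (2 * t) ^ N := by gcongr; linarith
      _ = 2 ^ N * t ^ N := by ring
      _ ≤ 2 ^ N * (1 + t ^ N) := by gcongr; linarith

theorem IsSmoothSection.decay' {c : ℕ} {f : ℤ → ℝ × ℝ → ℂ} (hf : IsSmoothSection c f) (N k : ℕ)
    (K : Set (ℝ × ℝ)) (hK : IsCompact K) :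
    ∃ C : ℝ, 0 ≤ C ∧ ∀ p : ℤ, ∀ z ∈ K, (1 + |(p : ℝ)|) ^ N * ‖iteratedFDeriv ℝ k (f p) z‖ ≤ C := by
  obtain ⟨C0, h0⟩ := hf.decay 0 k K hK
  obtain ⟨C1, h1⟩ := hf.decay N k K hK
  refine ⟨max 0 (2 ^ N * (C0 + C1)), le_max_left _ _, fun p z hz => le_trans ?_ (le_max_right _ _)⟩
  have a0 := h0 p z hz
  have a1 := h1 p z hz
  rw [pow_zero, one_mul] at a0
  calc (1 + |(p : ℝ)|) ^ N * ‖iteratedFDeriv ℝ k (f p) z‖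
      ≤ (2 ^ N * (1 + |(p : ℝ)| ^ N)) * ‖iteratedFDeriv ℝ k (f p) z‖ := by
        gcongr
        exact one_add_pow_le _ (abs_nonneg _) N
    _ = 2 ^ N * (‖iteratedFDeriv ℝ k (f p) z‖ + |(p : ℝ)| ^ N * ‖iteratedFDeriv ℝ k (f p) z‖) := by
        ring
    _ ≤ _ := by gcongr

theorem contDiff_e_mul (a : ℝ) : ContDiff ℝ ∞ (fun z : ℝ × ℝ => e (a * z.2)) :=
  e_contDiff.comp (by fun_prop)

theorem norm_iteratedFDeriv_e_mul (a : ℝ) (k : ℕ) (z : ℝ × ℝ) :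
    ‖iteratedFDeriv ℝ k (fun z : ℝ × ℝ => e (a * z.2)) z‖ ≤ (2 * Real.pi * |a|) ^ k := by
  let g : ℝ × ℝ →L[ℝ] ℝ := a • ContinuousLinearMap.snd ℝ ℝ ℝ
  have h : (fun z : ℝ × ℝ => e (a * z.2)) = e ∘ g := by ext z; simp [g]
  rw [h, g.iteratedFDeriv_comp_right e_contDiff z (by exact_mod_cast le_top)]
  refine (ContinuousMultilinearMap.norm_compContinuousLinearMap_le _ _).trans ?_
  rw [norm_iteratedFDeriv_eq_norm_iteratedDeriv, e_iteratedDeriv]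
  have hg : ‖g‖ ≤ |a| := by
    refine ContinuousLinearMap.opNorm_le_bound _ (abs_nonneg _) fun z => ?_
    simp only [g, smul_apply, ContinuousLinearMap.coe_snd', smul_eq_mul,
      norm_mul, Real.norm_eq_abs]
    gcongr
    exact norm_snd_le z
  simp only [norm_mul, norm_pow, norm_e, mul_one, Complex.norm_real, Complex.norm_I,
    Finset.prod_const, Finset.card_univ, Fintype.card_fin, Real.norm_eq_abs,
    abs_of_pos Real.pi_pos, abs_two]
  rw [mul_pow _ (|a|)]
  gcongr

/-- Global bounds: a `k`-th derivative grows at most like `(1 + ‖z‖) ^ k`. -/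
theorem IsSmoothSection.bound {c : ℕ} {f : ℤ → ℝ × ℝ → ℂ} (hf : IsSmoothSection c f) (N k : ℕ) :
    ∃ C : ℝ, 0 ≤ C ∧ ∀ (p : ℤ) (z : ℝ × ℝ),
      ‖iteratedFDeriv ℝ k (f p) z‖ ≤ C * (1 + ‖z‖) ^ k / (1 + |(p : ℝ)|) ^ N := by
  have hK : IsCompact (Set.Icc (0 : ℝ) 1 ×ˢ Set.Icc (0 : ℝ) 1) := isCompact_Icc.prod isCompact_Icc
  choose C hC0 hC using fun j => hf.decay' (N + k) j _ hK
  set A : ℝ := (2 * Real.pi * c + 1) with hA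
  have hA1 : 1 ≤ A := by rw [hA]; nlinarith [Real.pi_pos, (Nat.cast_nonneg c : (0:ℝ) ≤ c)]
  refine ⟨∑ i ∈ Finset.range (k + 1), (k.choose i : ℝ) * (A * 2) ^ k * C (k - i),
    Finset.sum_nonneg fun i _ => by have := hC0 (k - i); positivity, fun p z => ?_⟩
  set m := ⌊z.1⌋ with hm
  set n := ⌊z.2⌋ with hn
  have hper : ∀ (x y : ℝ), f p (x, y) =
      e ((c * m * p : ℝ) * y) * f p ((x, y) - ((m : ℝ), (n : ℝ))) := by
    intro x y
    have h1 := hf.quasiperiodic m p (x - m) y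
    have h2 := periodic_int (g := fun y => f p (x - m, y)) (fun y => hf.periodic p _ y) n (y - n)
    simp only [sub_add_cancel] at h1 h2
    rw [h1, h2]
    rfl
  have hfun : f p = fun z => (fun z : ℝ × ℝ => e ((c * m * p : ℝ) * z.2)) z *
      (fun z => f p (z - ((m : ℝ), (n : ℝ)))) z := by
    ext ⟨x, y⟩
    exact hper x y
  have hs : ContDiff ℝ ∞ (fun z => f p (z - ((m : ℝ), (n : ℝ)))) :=
    (hf.smooth p).comp (by fun_prop)
  rw [hfun]
  refine (norm_iteratedFDeriv_mul_le (contDiff_e_mul _) hs z (n := k)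
    (by exact_mod_cast le_top)).trans ?_
  rw [Finset.sum_mul, Finset.sum_div]
  refine Finset.sum_le_sum fun i hi => ?_
  have hik : i ≤ k := Nat.lt_succ_iff.mp (Finset.mem_range.mp hi)
  have hmem : z - ((m : ℝ), (n : ℝ)) ∈ Set.Icc (0 : ℝ) 1 ×ˢ Set.Icc (0 : ℝ) 1 := by
    refine ⟨⟨?_, ?_⟩, ⟨?_, ?_⟩⟩ <;> simp only [Prod.fst_sub, Prod.snd_sub, hm, hn]
    · linarith [Int.floor_le z.1]
    · linarith [Int.lt_floor_add_one z.1]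
    · linarith [Int.floor_le z.2]
    · linarith [Int.lt_floor_add_one z.2]
  have h2 := hC (k - i) p _ hmem
  rw [iteratedFDeriv_comp_sub]
  have hP : (0 : ℝ) < 1 + |(p : ℝ)| := by positivity
  have h1 : ‖iteratedFDeriv ℝ i (fun z : ℝ × ℝ => e ((c * m * p : ℝ) * z.2)) z‖ ≤
      (A * 2) ^ k * (1 + ‖z‖) ^ k * (1 + |(p : ℝ)|) ^ k := by
    refine (norm_iteratedFDeriv_e_mul _ _ _).trans ?_
    have hmb : |(m : ℝ)| ≤ 2 * (1 + ‖z‖) := by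
      have h3 : |z.1| ≤ ‖z‖ := norm_fst_le z
      have h4 : |(m : ℝ)| ≤ |z.1| + 1 := by
        rw [abs_le]
        have h5 := Int.floor_le z.1
        have h6 := Int.lt_floor_add_one z.1
        have h7 := neg_abs_le z.1
        have h8 := le_abs_self z.1
        rw [hm]
        constructor <;> linarith
      linarith [norm_nonneg z]
    have hb : 2 * Real.pi * |(c * m * p : ℝ)| ≤ A * 2 * (1 + ‖z‖) * (1 + |(p : ℝ)|) := by
      rw [abs_mul, abs_mul, Nat.abs_cast]
      calc 2 * Real.pi * (c * |(m : ℝ)| * |(p : ℝ)|) = (2 * Real.pi * c) * |(m : ℝ)| * |(p : ℝ)| := by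
            ring
        _ ≤ A * (2 * (1 + ‖z‖)) * (1 + |(p : ℝ)|) := by
            gcongr
            · linarith
            · linarith
        _ = _ := by ring
    calc (2 * Real.pi * |(c * m * p : ℝ)|) ^ i ≤ (A * 2 * (1 + ‖z‖) * (1 + |(p : ℝ)|)) ^ i := by
          have := Real.pi_pos
          gcongr
      _ ≤ (A * 2 * (1 + ‖z‖) * (1 + |(p : ℝ)|)) ^ k := by
          refine pow_le_pow_right₀ ?_ hik
          have : 1 ≤ A * 2 := by linarith
          have h9 : 1 ≤ 1 + ‖z‖ := by linarith [norm_nonneg z]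
          have h10 : 1 ≤ 1 + |(p : ℝ)| := by linarith [abs_nonneg (p : ℝ)]
          exact one_le_mul_of_one_le_of_one_le (one_le_mul_of_one_le_of_one_le this h9) h10
      _ = _ := by rw [mul_pow, mul_pow]
  rw [le_div_iff₀ (by positivity)]
  calc (k.choose i : ℝ) * ‖iteratedFDeriv ℝ i (fun z : ℝ × ℝ => e ((c * m * p : ℝ) * z.2)) z‖ *
        ‖iteratedFDeriv ℝ (k - i) (f p) (z - ((m : ℝ), (n : ℝ)))‖ * (1 + |(p : ℝ)|) ^ N
      ≤ (k.choose i : ℝ) * ((A * 2) ^ k * (1 + ‖z‖) ^ k * (1 + |(p : ℝ)|) ^ k) *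
        ‖iteratedFDeriv ℝ (k - i) (f p) (z - ((m : ℝ), (n : ℝ)))‖ * (1 + |(p : ℝ)|) ^ N := by
        gcongr
    _ = (k.choose i : ℝ) * ((A * 2) ^ k * (1 + ‖z‖) ^ k) * ((1 + |(p : ℝ)|) ^ (N + k) *
        ‖iteratedFDeriv ℝ (k - i) (f p) (z - ((m : ℝ), (n : ℝ)))‖) := by
        rw [pow_add]; ring
    _ ≤ (k.choose i : ℝ) * ((A * 2) ^ k * (1 + ‖z‖) ^ k) * C (k - i) := by
        gcongr
    _ = _ := by ring

/-- Differentiation of a series under local summable bounds. -/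
theorem hasFDerivAt_tsum_local {ι F : Type*} [NormedAddCommGroup F] [NormedSpace ℝ F]
    [CompleteSpace F] {f : ι → ℝ × ℝ → F} (hf : ∀ i, Differentiable ℝ (f i))
    (h0 : ∀ z, Summable fun i => f i z)
    (hb : ∀ R : ℝ, ∃ v : ι → ℝ, Summable v ∧ ∀ i z, ‖z‖ < R → ‖fderiv ℝ (f i) z‖ ≤ v i)
    (z : ℝ × ℝ) : HasFDerivAt (fun z => ∑' i, f i z) (∑' i, fderiv ℝ (f i) z) z := by
  obtain ⟨v, hv, hvb⟩ := hb (‖z‖ + 1)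
  refine hasFDerivAt_tsum_of_isPreconnected (s := Metric.ball 0 (‖z‖ + 1)) (x₀ := z) hv
    Metric.isOpen_ball (convex_ball _ _).isPreconnected (fun i x _ => (hf i x).hasFDerivAt)
    (fun i x hx => hvb i x (by simpa using hx)) (by simp) (h0 z) (by simp)

theorem iteratedFDeriv_tsum_local {ι : Type*} {f : ι → ℝ × ℝ → ℂ} (hf : ∀ i, ContDiff ℝ ∞ (f i))
    (hb : ∀ (k : ℕ) (R : ℝ), ∃ v : ι → ℝ, Summable v ∧
      ∀ i z, ‖z‖ < R → ‖iteratedFDeriv ℝ k (f i) z‖ ≤ v i) :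
    (∀ k, iteratedFDeriv ℝ k (fun z => ∑' i, f i z) = fun z => ∑' i, iteratedFDeriv ℝ k (f i) z) ∧
      ContDiff ℝ ∞ (fun z => ∑' i, f i z) := by
  have hsum : ∀ k z, Summable fun i => iteratedFDeriv ℝ k (f i) z := fun k z => by
    obtain ⟨v, hv, hvb⟩ := hb k (‖z‖ + 1)
    exact Summable.of_norm_bounded hv fun i => hvb i z (by simp)
  have hd : ∀ k z, HasFDerivAt (fun z => ∑' i, iteratedFDeriv ℝ k (f i) z)
      (∑' i, fderiv ℝ (iteratedFDeriv ℝ k (f i)) z) z := fun k z => by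
    refine hasFDerivAt_tsum_local (fun i => (hf i).differentiable_iteratedFDeriv
      (by exact_mod_cast WithTop.coe_lt_top _)) (hsum k) (fun R => ?_) z
    obtain ⟨v, hv, hvb⟩ := hb (k + 1) R
    refine ⟨v, hv, fun i z hz => ?_⟩
    rw [fderiv_iteratedFDeriv, Function.comp_apply, LinearIsometryEquiv.norm_map]
    exact hvb i z hz
  have hk : ∀ k, iteratedFDeriv ℝ k (fun z => ∑' i, f i z) =
      fun z => ∑' i, iteratedFDeriv ℝ k (f i) z := by
    intro k
    induction k with
    | zero =>
      ext1 z
      simp_rw [iteratedFDeriv_zero_eq_comp]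
      exact (continuousMultilinearCurryFin0 ℝ (ℝ × ℝ) ℂ).symm.toContinuousLinearEquiv.map_tsum
    | succ k ih =>
      ext1 z
      rw [iteratedFDeriv_succ_eq_comp_left, Function.comp_apply, ih, (hd k z).fderiv]
      simp_rw [iteratedFDeriv_succ_eq_comp_left]
      exact (continuousMultilinearCurryLeftEquiv ℝ
        (fun _ : Fin (k + 1) => ℝ × ℝ) ℂ).symm.toContinuousLinearEquiv.map_tsum
  refine ⟨hk, contDiff_of_differentiable_iteratedFDeriv fun m _ => ?_⟩
  rw [hk]
  exact fun z => (hd m z).differentiableAt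


/-- The translation vector `n ħ (μ, ν)`. -/
def step (h mu nu : ℝ) (n : ℤ) : ℝ × ℝ := (h * n * mu, h * n * nu)

/-- The `q`-th term of the product series. -/
def mulTerm (h mu nu : ℝ) (f g : ℤ → ℝ × ℝ → ℂ) (p q : ℤ) (z : ℝ × ℝ) : ℂ :=
  f q (z - step h mu nu (q - p)) * g (p - q) (z - step h mu nu q)

/-- The twisted convolution
`(f ⋆ g)(x, y, p) = ∑_q f(x - ħ(q-p)μ, y - ħ(q-p)ν, q) g(x - ħqμ, y - ħqν, p - q)`. -/
def starMul (h mu nu : ℝ) (f g : ℤ → ℝ × ℝ → ℂ) (p : ℤ) (z : ℝ × ℝ) : ℂ :=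
  ∑' q : ℤ, mulTerm h mu nu f g p q z

/-- The involution `f^*(x, y, p) = conj (f(x, y, -p))`. -/
def starConj (f : ℤ → ℝ × ℝ → ℂ) (p : ℤ) (z : ℝ × ℝ) : ℂ := (starRingEnd ℂ) (f (-p) z)

variable {c : ℕ} {h mu nu : ℝ} {f g k : ℤ → ℝ × ℝ → ℂ}

theorem step_add (m n : ℤ) : step h mu nu (m + n) = step h mu nu m + step h mu nu n := by
  ext <;> simp [step] <;> ring

theorem step_sub (m n : ℤ) : step h mu nu (m - n) = step h mu nu m - step h mu nu n := by
  ext <;> simp [step] <;> ring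

theorem step_neg (m : ℤ) : step h mu nu (-m) = - step h mu nu m := by
  ext <;> simp [step]

theorem step_zero : step h mu nu 0 = 0 := by
  ext <;> simp [step]

theorem norm_step_le (n : ℤ) : ‖step h mu nu n‖ ≤ |h| * (|mu| + |nu|) * |(n : ℝ)| := by
  rw [step, Prod.norm_def]
  simp only [norm_mul, Real.norm_eq_abs]
  refine max_le ?_ ?_
  · calc |h| * |(n : ℝ)| * |mu| = |h| * |mu| * |(n : ℝ)| := by ring
      _ ≤ _ := by gcongr; linarith [abs_nonneg nu]
  · calc |h| * |(n : ℝ)| * |nu| = |h| * |nu| * |(n : ℝ)| := by ring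
      _ ≤ _ := by gcongr; linarith [abs_nonneg mu]

theorem summable_inv_sq : Summable fun q : ℤ => 1 / (1 + |(q : ℝ)|) ^ 2 := by
  have h1 : Summable fun q : ℤ => 1 / |(q : ℝ)| ^ 2 := by
    have := Real.summable_abs_int_rpow (b := 2) (by norm_num)
    refine this.congr fun q => ?_
    rw [Real.rpow_neg (abs_nonneg _), one_div]
    norm_num
  refine Summable.of_norm_bounded_eventually h1 ?_
  filter_upwards [(Set.finite_singleton (0 : ℤ)).compl_mem_cofinite] with q hq
  have hq0 : (0 : ℝ) < |(q : ℝ)| := abs_pos.mpr (by exact_mod_cast hq)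
  rw [Real.norm_of_nonneg (by positivity)]
  gcongr
  linarith

theorem contDiff_mulTerm (hf : IsSmoothSection c f) (hg : IsSmoothSection c g) (p q : ℤ) :
    ContDiff ℝ ∞ (mulTerm h mu nu f g p q) := by
  unfold mulTerm
  exact ((hf.smooth q).comp (contDiff_id.sub contDiff_const)).mul
    ((hg.smooth (p - q)).comp (contDiff_id.sub contDiff_const))

theorem mulTerm_bound (hf : IsSmoothSection c f) (hg : IsSmoothSection c g) (N k : ℕ) (R : ℝ) :
    ∃ C : ℝ, 0 ≤ C ∧ ∀ (p q : ℤ) (z : ℝ × ℝ), ‖z‖ ≤ R →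
      ‖iteratedFDeriv ℝ k (mulTerm h mu nu f g p q) z‖ ≤
        C / (1 + |(p : ℝ)|) ^ N * (1 / (1 + |(q : ℝ)|) ^ 2) := by
  choose Cf hCf0 hCf using fun j => hf.bound (N + k + 2) j
  choose Cg hCg0 hCg using fun j => hg.bound (N + k + 2) j
  set B : ℝ := |h| * (|mu| + |nu|) with hB
  have hB0 : 0 ≤ B := by positivity
  set S : ℝ := 1 + |R| + B with hS
  have hS1 : 1 ≤ S := by rw [hS]; linarith [abs_nonneg R]
  refine ⟨∑ i ∈ Finset.range (k + 1), (k.choose i : ℝ) * (Cf i * S ^ k) * (Cg (k - i) * S ^ k),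
    Finset.sum_nonneg fun i _ => by
      have := hCf0 i; have := hCg0 (k - i); positivity, fun p q z hz => ?_⟩
  have hshift : ∀ n : ℤ, 1 + ‖z - step h mu nu n‖ ≤ S * (1 + |(n : ℝ)|) := by
    intro n
    have h1 := norm_sub_le z (step h mu nu n)
    have h2 := norm_step_le (h := h) (mu := mu) (nu := nu) n
    rw [← hB] at h2
    have h3 := le_abs_self R
    rw [hS]
    nlinarith [abs_nonneg (n : ℝ), abs_nonneg R, mul_nonneg (abs_nonneg R) (abs_nonneg (n : ℝ))]
  have h1 : ContDiff ℝ ∞ (fun z => f q (z - step h mu nu (q - p))) :=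
    (hf.smooth q).comp (contDiff_id.sub contDiff_const)
  have h2 : ContDiff ℝ ∞ (fun z => g (p - q) (z - step h mu nu q)) :=
    (hg.smooth (p - q)).comp (contDiff_id.sub contDiff_const)
  have h3 := norm_iteratedFDeriv_mul_le h1 h2 z (n := k) (by exact_mod_cast le_top)
  refine le_trans h3 ?_
  rw [Finset.sum_div, Finset.sum_mul]
  refine Finset.sum_le_sum fun i hi => ?_
  have hik : i ≤ k := Nat.lt_succ_iff.mp (Finset.mem_range.mp hi)
  rw [iteratedFDeriv_comp_sub, iteratedFDeriv_comp_sub]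
  set X : ℝ := 1 + |(q : ℝ)| with hX
  set Y : ℝ := 1 + |((p - q : ℤ) : ℝ)| with hY
  have hX1 : 1 ≤ X := by rw [hX]; linarith [abs_nonneg (q : ℝ)]
  have hY1 : 1 ≤ Y := by rw [hY]; linarith [abs_nonneg ((p - q : ℤ) : ℝ)]
  have hYq : 1 + |((q - p : ℤ) : ℝ)| = Y := by
    rw [hY]; push_cast; rw [abs_sub_comm]
  have hF : ‖iteratedFDeriv ℝ i (f q) (z - step h mu nu (q - p))‖ ≤
      Cf i * (S ^ k * Y ^ k) / X ^ (N + k + 2) := by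
    refine (hCf i q _).trans ?_
    gcongr
    · exact hCf0 i
    calc (1 + ‖z - step h mu nu (q - p)‖) ^ i ≤ (S * Y) ^ i := by
          have := hshift (q - p)
          rw [hYq] at this
          gcongr
      _ ≤ (S * Y) ^ k := pow_le_pow_right₀ (one_le_mul_of_one_le_of_one_le hS1 hY1) hik
      _ = _ := by rw [mul_pow]
  have hG : ‖iteratedFDeriv ℝ (k - i) (g (p - q)) (z - step h mu nu q)‖ ≤
      Cg (k - i) * (S ^ k * X ^ k) / Y ^ (N + k + 2) := by
    refine (hCg (k - i) (p - q) _).trans ?_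
    gcongr
    · exact hCg0 (k - i)
    calc (1 + ‖z - step h mu nu q‖) ^ (k - i) ≤ (S * X) ^ (k - i) := by
          have := hshift q
          gcongr
      _ ≤ (S * X) ^ k :=
          pow_le_pow_right₀ (one_le_mul_of_one_le_of_one_le hS1 hX1) (Nat.sub_le _ _)
      _ = _ := by rw [mul_pow]
  have hXY : 1 + |(p : ℝ)| ≤ X * Y := by
    have h4 : |(p : ℝ)| ≤ |(q : ℝ)| + |((p - q : ℤ) : ℝ)| := by
      calc |(p : ℝ)| = |(q : ℝ) + ((p - q : ℤ) : ℝ)| := by push_cast; ring_nf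
        _ ≤ _ := abs_add_le _ _
    rw [hX, hY]
    nlinarith [abs_nonneg (q : ℝ), abs_nonneg ((p - q : ℤ) : ℝ),
      mul_nonneg (abs_nonneg (q : ℝ)) (abs_nonneg ((p - q : ℤ) : ℝ))]
  have hCC : 0 ≤ (k.choose i : ℝ) * (Cf i * S ^ k) * (Cg (k - i) * S ^ k) := by
    have := hCf0 i; have := hCg0 (k - i); positivity
  have hX0 : 0 < X := by linarith
  have hY0 : 0 < Y := by linarith
  calc (k.choose i : ℝ) * ‖iteratedFDeriv ℝ i (f q) (z - step h mu nu (q - p))‖ *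
        ‖iteratedFDeriv ℝ (k - i) (g (p - q)) (z - step h mu nu q)‖
      ≤ (k.choose i : ℝ) * (Cf i * (S ^ k * Y ^ k) / X ^ (N + k + 2)) *
        (Cg (k - i) * (S ^ k * X ^ k) / Y ^ (N + k + 2)) := by
        gcongr
        have := hCf0 i
        positivity
    _ = (k.choose i : ℝ) * (Cf i * S ^ k) * (Cg (k - i) * S ^ k) *
        (1 / (X * Y) ^ N * (1 / (X ^ 2 * Y ^ 2))) := by
        field_simp
        ring_nf
    _ ≤ (k.choose i : ℝ) * (Cf i * S ^ k) * (Cg (k - i) * S ^ k) *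
        (1 / (1 + |(p : ℝ)|) ^ N * (1 / (X ^ 2 * 1))) := by
        gcongr
        exact one_le_pow₀ hY1
    _ = _ := by
        rw [mul_one]; ring

theorem summable_mulTerm (hf : IsSmoothSection c f) (hg : IsSmoothSection c g) (p : ℤ)
    (z : ℝ × ℝ) : Summable fun q => mulTerm h mu nu f g p q z := by
  obtain ⟨C, -, hC⟩ := mulTerm_bound (h := h) (mu := mu) (nu := nu) hf hg 0 0 ‖z‖
  refine Summable.of_norm_bounded (summable_inv_sq.mul_left C) fun q => ?_
  have := hC p q z le_rfl
  simpa using this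

theorem starMul_aux (hf : IsSmoothSection c f) (hg : IsSmoothSection c g) (p : ℤ) :
    (∀ k, iteratedFDeriv ℝ k (starMul h mu nu f g p) =
      fun z => ∑' q, iteratedFDeriv ℝ k (mulTerm h mu nu f g p q) z) ∧
      ContDiff ℝ ∞ (starMul h mu nu f g p) := by
  refine iteratedFDeriv_tsum_local (contDiff_mulTerm hf hg p) fun k R => ?_
  obtain ⟨C, -, hC⟩ := mulTerm_bound (h := h) (mu := mu) (nu := nu) hf hg 0 k R
  refine ⟨_, summable_inv_sq.mul_left C, fun q z hz => ?_⟩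
  simpa using hC p q z hz.le

theorem IsSmoothSection.starMul (h mu nu : ℝ) (hf : IsSmoothSection c f)
    (hg : IsSmoothSection c g) : IsSmoothSection c (starMul h mu nu f g) where
  smooth p := (starMul_aux hf hg p).2
  periodic p x y := by
    unfold QHM.starMul mulTerm
    congr 1
    ext q
    have e1 : ∀ a : ℝ × ℝ, (x, y + 1) - a = (x - a.1, y - a.2 + 1) := fun a => by
      ext <;> simp; ring
    have e2 : ∀ a : ℝ × ℝ, (x, y) - a = (x - a.1, y - a.2) := fun a => by
      ext <;> simp
    rw [e1, e1, e2, e2, hf.periodic, hg.periodic]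
  quasiperiodic k p x y := by
    unfold QHM.starMul mulTerm
    rw [← tsum_mul_left]
    congr 1
    ext q
    have e1 : ∀ a : ℝ × ℝ, (x + k, y) - a = (x - a.1 + k, y - a.2) := fun a => by
      ext <;> simp; ring
    have e2 : ∀ a : ℝ × ℝ, (x, y) - a = (x - a.1, y - a.2) := fun a => by
      ext <;> simp
    rw [e1, e1, e2, e2, hf.quasiperiodic, hg.quasiperiodic, mul_mul_mul_comm, ← e_add]
    congr 2
    simp only [step]
    push_cast
    ring
  decay N k K hK := by
    obtain ⟨R, hR⟩ := hK.isBounded.exists_norm_le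
    obtain ⟨C, hC0, hC⟩ := mulTerm_bound (h := h) (mu := mu) (nu := nu) hf hg N k R
    refine ⟨C * ∑' q : ℤ, 1 / (1 + |(q : ℝ)|) ^ 2, fun p z hz => ?_⟩
    rw [(starMul_aux hf hg p).1]
    have hs := summable_inv_sq.mul_left (C / (1 + |(p : ℝ)|) ^ N)
    have h1 : ‖∑' q, iteratedFDeriv ℝ k (mulTerm h mu nu f g p q) z‖ ≤
        C / (1 + |(p : ℝ)|) ^ N * ∑' q : ℤ, 1 / (1 + |(q : ℝ)|) ^ 2 := by
      rw [← tsum_mul_left]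
      exact tsum_of_norm_bounded hs.hasSum fun q => hC p q z (hR z hz)
    have hT : 0 ≤ ∑' q : ℤ, 1 / (1 + |(q : ℝ)|) ^ 2 := tsum_nonneg fun q => by positivity
    calc |(p : ℝ)| ^ N * ‖∑' q, iteratedFDeriv ℝ k (mulTerm h mu nu f g p q) z‖
        ≤ (1 + |(p : ℝ)|) ^ N * (C / (1 + |(p : ℝ)|) ^ N * ∑' q : ℤ, 1 / (1 + |(q : ℝ)|) ^ 2) := by
          gcongr
          linarith
      _ = _ := by field_simp

theorem norm_iteratedFDeriv_conj (k : ℕ) (F : ℝ × ℝ → ℂ) (z : ℝ × ℝ) :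
    ‖iteratedFDeriv ℝ k (fun z => (starRingEnd ℂ) (F z)) z‖ = ‖iteratedFDeriv ℝ k F z‖ :=
  Complex.conjLIE.norm_iteratedFDeriv_comp_left F z k

theorem IsSmoothSection.starConj (hf : IsSmoothSection c f) :
    IsSmoothSection c (starConj f) where
  smooth p := Complex.conjCLE.contDiff.comp (hf.smooth (-p))
  periodic p x y := by unfold QHM.starConj; rw [hf.periodic]
  quasiperiodic k p x y := by
    unfold QHM.starConj
    rw [hf.quasiperiodic, map_mul, e_conj]
    congr 2
    push_cast
    ring
  decay N k K hK := by
    obtain ⟨C, hC⟩ := hf.decay N k K hK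
    refine ⟨C, fun p z hz => ?_⟩
    have := hC (-p) z hz
    unfold QHM.starConj
    rw [norm_iteratedFDeriv_conj]
    simpa using this

theorem IsSmoothSection.add (hf : IsSmoothSection c f) (hg : IsSmoothSection c g) :
    IsSmoothSection c (f + g) where
  smooth p := (hf.smooth p).add (hg.smooth p)
  periodic p x y := by simp [hf.periodic, hg.periodic]
  quasiperiodic k p x y := by simp [hf.quasiperiodic, hg.quasiperiodic, mul_add]
  decay N k K hK := by
    obtain ⟨C, hC⟩ := hf.decay N k K hK
    obtain ⟨D, hD⟩ := hg.decay N k K hK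
    refine ⟨C + D, fun p z hz => ?_⟩
    rw [Pi.add_apply, iteratedFDeriv_add_apply
      ((hf.smooth p).contDiffAt.of_le (by exact_mod_cast le_top))
      ((hg.smooth p).contDiffAt.of_le (by exact_mod_cast le_top))]
    calc _ ≤ |(p : ℝ)| ^ N * (‖iteratedFDeriv ℝ k (f p) z‖ + ‖iteratedFDeriv ℝ k (g p) z‖) := by
          gcongr
          exact norm_add_le _ _
      _ ≤ _ := by rw [mul_add]; exact add_le_add (hC p z hz) (hD p z hz)

theorem IsSmoothSection.smul (a : ℂ) (hf : IsSmoothSection c f) :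
    IsSmoothSection c (a • f) where
  smooth p := (contDiff_const (c := a)).smul (hf.smooth p)
  periodic p x y := by simp [hf.periodic]
  quasiperiodic k p x y := by simp [hf.quasiperiodic]; ring
  decay N k K hK := by
    obtain ⟨C, hC⟩ := hf.decay N k K hK
    refine ⟨‖a‖ * C, fun p z hz => ?_⟩
    rw [Pi.smul_apply, iteratedFDeriv_const_smul_apply
      ((hf.smooth p).contDiffAt.of_le (by exact_mod_cast le_top)), norm_smul]
    calc _ = ‖a‖ * (|(p : ℝ)| ^ N * ‖iteratedFDeriv ℝ k (f p) z‖) := by ring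
      _ ≤ _ := by gcongr; exact hC p z hz

theorem IsSmoothSection.zero : IsSmoothSection c (0 : ℤ → ℝ × ℝ → ℂ) where
  smooth p := contDiff_const
  periodic p x y := rfl
  quasiperiodic k p x y := by simp
  decay N k K hK := ⟨0, fun p z _ => by
    have : iteratedFDeriv ℝ k ((0 : ℤ → ℝ × ℝ → ℂ) p) z = 0 := by
      simp [Pi.zero_def]
    rw [this]; simp⟩

/-- The unit: `1` at `p = 0`, zero elsewhere. -/
def starOne (p : ℤ) (_ : ℝ × ℝ) : ℂ := if p = 0 then 1 else 0

theorem IsSmoothSection.starOne : IsSmoothSection c starOne where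
  smooth p := contDiff_const
  periodic p x y := rfl
  quasiperiodic k p x y := by
    unfold QHM.starOne
    split_ifs with hp
    · subst hp; simp [e]
    · simp
  decay N k K hK := by
    refine ⟨1, fun p z _ => ?_⟩
    by_cases hp : p = 0
    · subst hp
      have h1 : ‖iteratedFDeriv ℝ k (QHM.starOne 0) z‖ ≤ 1 := by
        have : QHM.starOne 0 = fun _ => (1 : ℂ) := by ext; simp [QHM.starOne]
        rw [this]
        rcases k with _ | k
        · simp
        · rw [iteratedFDeriv_succ_const]; simp
      calc _ ≤ (1 : ℝ) * 1 := by
            gcongr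
            rcases N with _ | N <;> simp
        _ = 1 := one_mul 1
    · have : QHM.starOne p = fun _ => (0 : ℂ) := by ext; simp [QHM.starOne, hp]
      rw [this]
      have h0 : iteratedFDeriv ℝ k (fun _ : ℝ × ℝ => (0 : ℂ)) z = 0 := by simp
      rw [h0]; simp


/-- The space `S^c`. -/
def smoothSections (c : ℕ) : Submodule ℂ (ℤ → ℝ × ℝ → ℂ) where
  carrier := {f | IsSmoothSection c f}
  add_mem' hf hg := hf.add hg
  zero_mem' := IsSmoothSection.zero
  smul_mem' a _ hf := hf.smul a

/-- The smooth quantum Heisenberg algebra `𝒜^∞_ħ`: the space `S^c` with the product and the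
involution determined by `ħ, μ, ν`. -/
@[nolint unusedArguments]
def SmoothAlgebra (c : ℕ) (_h _mu _nu : ℝ) : Type := smoothSections c

namespace SmoothAlgebra

variable {c : ℕ} {h mu nu : ℝ}

instance : AddCommGroup (SmoothAlgebra c h mu nu) :=
  inferInstanceAs (AddCommGroup (smoothSections c))

instance : Module ℂ (SmoothAlgebra c h mu nu) :=
  inferInstanceAs (Module ℂ (smoothSections c))

/-- The underlying function on `ℤ × ℝ²`. -/
def fn (a : SmoothAlgebra c h mu nu) : ℤ → ℝ × ℝ → ℂ :=
  Subtype.val (p := (· ∈ smoothSections c)) a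

theorem isSmoothSection (a : SmoothAlgebra c h mu nu) : IsSmoothSection c a.fn :=
  Subtype.property (p := (· ∈ smoothSections c)) a

/-- An element of the algebra from its underlying function. -/
def mk (f : ℤ → ℝ × ℝ → ℂ) (hf : IsSmoothSection c f) : SmoothAlgebra c h mu nu :=
  Subtype.mk (p := (· ∈ smoothSections c)) f hf

@[simp] theorem fn_mk (f : ℤ → ℝ × ℝ → ℂ) (hf : IsSmoothSection c f) :
    (mk f hf : SmoothAlgebra c h mu nu).fn = f := rfl

theorem fn_injective : Function.Injective (fn : SmoothAlgebra c h mu nu → ℤ → ℝ × ℝ → ℂ) :=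
  Subtype.val_injective

theorem ext {a b : SmoothAlgebra c h mu nu} (hab : ∀ p z, a.fn p z = b.fn p z) : a = b :=
  fn_injective (funext fun p => funext fun z => hab p z)

@[simp] theorem fn_add (a b : SmoothAlgebra c h mu nu) : (a + b).fn = a.fn + b.fn := rfl
@[simp] theorem fn_zero : (0 : SmoothAlgebra c h mu nu).fn = 0 := rfl
@[simp] theorem fn_neg (a : SmoothAlgebra c h mu nu) : (-a).fn = -a.fn := rfl
@[simp] theorem fn_sub (a b : SmoothAlgebra c h mu nu) : (a - b).fn = a.fn - b.fn := rfl
@[simp] theorem fn_smul (r : ℂ) (a : SmoothAlgebra c h mu nu) : (r • a).fn = r • a.fn := rfl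

instance : Mul (SmoothAlgebra c h mu nu) :=
  ⟨fun a b => mk (starMul h mu nu a.fn b.fn)
    (a.isSmoothSection.starMul h mu nu b.isSmoothSection)⟩

instance : One (SmoothAlgebra c h mu nu) := ⟨mk starOne IsSmoothSection.starOne⟩

instance : Star (SmoothAlgebra c h mu nu) :=
  ⟨fun a => mk (starConj a.fn) a.isSmoothSection.starConj⟩

theorem fn_mul (a b : SmoothAlgebra c h mu nu) : (a * b).fn = starMul h mu nu a.fn b.fn := rfl
theorem fn_one : (1 : SmoothAlgebra c h mu nu).fn = starOne := rfl
theorem fn_star (a : SmoothAlgebra c h mu nu) : (star a).fn = starConj a.fn := rfl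

theorem summable_term (a b : SmoothAlgebra c h mu nu) (p : ℤ) (z : ℝ × ℝ) :
    Summable fun q => mulTerm h mu nu a.fn b.fn p q z :=
  summable_mulTerm a.isSmoothSection b.isSmoothSection p z

/-- The coefficients are bounded by a summable sequence. -/
theorem exists_bound (a : SmoothAlgebra c h mu nu) :
    ∃ A : ℤ → ℝ, Summable A ∧ (∀ q, 0 ≤ A q) ∧ ∀ q z, ‖a.fn q z‖ ≤ A q := by
  obtain ⟨C, hC0, hC⟩ := a.isSmoothSection.bound 2 0
  refine ⟨fun q => C * (1 / (1 + |(q : ℝ)|) ^ 2), summable_inv_sq.mul_left C,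
    fun q => by positivity, fun q z => ?_⟩
  have := hC q z
  simp only [norm_iteratedFDeriv_zero, pow_zero, mul_one] at this
  rwa [← mul_one_div] at this

theorem mul_assoc' (a b d : SmoothAlgebra c h mu nu) : a * b * d = a * (b * d) := by
  refine ext fun p z => ?_
  obtain ⟨A, hA, hA0, hAb⟩ := exists_bound a
  obtain ⟨B, hB, hB0, hBb⟩ := exists_bound b
  obtain ⟨D, hD, hD0, hDb⟩ := exists_bound d
  let F : ℤ → ℤ → ℂ := fun r s => a.fn r (z - step h mu nu (r - p)) *
    (b.fn s (z - step h mu nu r - step h mu nu (s - (p - r))) *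
      d.fn (p - r - s) (z - step h mu nu r - step h mu nu s))
  have hF : Summable (Function.uncurry F) := by
    have h1 : Summable fun x : ℤ × ℤ => A x.1 * B x.2 * ∑' q, D q :=
      (hA.mul_of_nonneg hB hA0 hB0).mul_right _
    refine Summable.of_norm_bounded h1 fun x => ?_
    simp only [Function.uncurry, F, norm_mul]
    rw [← mul_assoc]
    gcongr
    · have := hA0 x.1; have := hB0 x.2; positivity
    · exact hA0 _
    · exact hAb _ _
    · exact hBb _ _
    · exact (hDb _ _).trans (hD.le_tsum _ fun q _ => hD0 q)
  have hR : (a * (b * d)).fn p z = ∑' r, ∑' s, F r s := by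
    simp only [fn_mul, starMul, mulTerm, F]
    congr 1; ext r
    rw [← tsum_mul_left]
  have hL : (a * b * d).fn p z = ∑' q, ∑' r, F r (q - r) := by
    simp only [fn_mul, starMul, mulTerm, F]
    congr 1; ext q
    rw [← tsum_mul_right]
    congr 1; ext r
    rw [mul_assoc]
    have e1 : z - step h mu nu (q - p) - step h mu nu (r - q) = z - step h mu nu (r - p) := by
      simp only [step_sub]; abel
    have e2 : z - step h mu nu (q - p) - step h mu nu r =
        z - step h mu nu r - step h mu nu (q - r - (p - r)) := by
      simp only [step_sub]; abel
    have e3 : z - step h mu nu q = z - step h mu nu r - step h mu nu (q - r) := by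
      simp only [step_sub]; abel
    have e4 : p - q = p - r - (q - r) := by ring
    rw [e1, e2, e3, ← e4]
  let σ : ℤ × ℤ ≃ ℤ × ℤ :=
    { toFun := fun x => (x.1, x.2 - x.1)
      invFun := fun x => (x.1, x.2 + x.1)
      left_inv := fun x => by simp
      right_inv := fun x => by simp }
  have hG : Summable (Function.uncurry fun r q => F r (q - r)) := σ.summable_iff.mpr hF
  rw [hL, hR, hG.tsum_comm]
  congr 1; ext r
  exact (Equiv.subRight r).tsum_eq (F r)

theorem one_mul' (a : SmoothAlgebra c h mu nu) : 1 * a = a := by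
  refine ext fun p z => ?_
  simp only [fn_mul, starMul, mulTerm, fn_one, starOne]
  rw [tsum_eq_single 0 (fun q hq => by simp [hq])]
  simp [step_zero]

theorem mul_one' (a : SmoothAlgebra c h mu nu) : a * 1 = a := by
  refine ext fun p z => ?_
  simp only [fn_mul, starMul, mulTerm, fn_one, starOne]
  rw [tsum_eq_single p (fun q hq => by rw [if_neg (by omega), mul_zero])]
  simp [step_zero]

theorem left_distrib' (a b d : SmoothAlgebra c h mu nu) : a * (b + d) = a * b + a * d := by
  refine ext fun p z => ?_
  have h1 := (summable_term a b p z).tsum_add (summable_term a d p z)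
  simp only [fn_mul, fn_add, starMul, Pi.add_apply]
  rw [← h1]
  congr 1; ext q
  simp only [mulTerm, Pi.add_apply, mul_add]

theorem right_distrib' (a b d : SmoothAlgebra c h mu nu) : (a + b) * d = a * d + b * d := by
  refine ext fun p z => ?_
  have h1 := (summable_term a d p z).tsum_add (summable_term b d p z)
  simp only [fn_mul, fn_add, starMul, Pi.add_apply]
  rw [← h1]
  congr 1; ext q
  simp only [mulTerm, Pi.add_apply, add_mul]

instance : Ring (SmoothAlgebra c h mu nu) :=
  { (inferInstance : AddCommGroup (SmoothAlgebra c h mu nu)) with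
    mul := (· * ·)
    one := 1
    mul_assoc := mul_assoc'
    one_mul := one_mul'
    mul_one := mul_one'
    left_distrib := left_distrib'
    right_distrib := right_distrib'
    zero_mul := fun a => by
      have h1 := right_distrib' 0 0 a
      rw [add_zero] at h1
      exact left_eq_add.mp h1
    mul_zero := fun a => by
      have h1 := left_distrib' a 0 0
      rw [add_zero] at h1
      exact left_eq_add.mp h1 }

instance : Algebra ℂ (SmoothAlgebra c h mu nu) :=
  Algebra.ofModule
    (fun r a b => ext fun p z => by
      simp only [fn_mul, fn_smul, starMul, mulTerm, Pi.smul_apply, smul_eq_mul]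
      rw [← tsum_mul_left]
      congr 1; ext q; ring)
    (fun r a b => ext fun p z => by
      simp only [fn_mul, fn_smul, starMul, mulTerm, Pi.smul_apply, smul_eq_mul]
      rw [← tsum_mul_left]
      congr 1; ext q; ring)

instance : StarRing (SmoothAlgebra c h mu nu) where
  star_involutive a := ext fun p z => by simp [fn_star, starConj]
  star_mul a b := ext fun p z => by
    simp only [fn_star, starConj, fn_mul, starMul, mulTerm]
    rw [Complex.conj_tsum, ← (Equiv.subRight p).tsum_eq]
    congr 1; ext q
    simp only [Equiv.subRight_apply, map_mul]
    rw [mul_comm]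
    congr 4 <;> congr 1 <;> ring_nf
  star_add a b := ext fun p z => by simp [fn_star, starConj]

instance : StarModule ℂ (SmoothAlgebra c h mu nu) where
  star_smul r a := ext fun p z => by simp [fn_star, starConj]

end SmoothAlgebra


/-- `∂f/∂x` and `∂f/∂y` are the directional derivatives along `(1, 0)` and `(0, 1)`. -/
def partialDeriv (v : ℝ × ℝ) (f : ℤ → ℝ × ℝ → ℂ) (p : ℤ) (z : ℝ × ℝ) : ℂ := fderiv ℝ (f p) z v

/-- `d₁ f = -∂f/∂x`. -/
def d1Fun (f : ℤ → ℝ × ℝ → ℂ) (p : ℤ) (z : ℝ × ℝ) : ℂ := -partialDeriv (1, 0) f p z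

/-- `d₂ f = 2πi c p x f - ∂f/∂y`. -/
def d2Fun (c : ℕ) (f : ℤ → ℝ × ℝ → ℂ) (p : ℤ) (z : ℝ × ℝ) : ℂ :=
  2 * Real.pi * Complex.I * c * p * z.1 * f p z - partialDeriv (0, 1) f p z

/-- `d₃ f = 2πi p c α f`. -/
def d3Fun (c : ℕ) (alpha : ℝ) (f : ℤ → ℝ × ℝ → ℂ) (p : ℤ) (z : ℝ × ℝ) : ℂ :=
  2 * Real.pi * Complex.I * p * c * alpha * f p z

variable {c : ℕ} {h mu nu : ℝ} {f g : ℤ → ℝ × ℝ → ℂ}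

theorem IsSmoothSection.differentiable (hf : IsSmoothSection c f) (p : ℤ) :
    Differentiable ℝ (f p) := (hf.smooth p).differentiable (by simp)

theorem fderiv_translate (F : ℝ × ℝ → ℂ) (a z : ℝ × ℝ) :
    fderiv ℝ (fun z => F (z + a)) z = fderiv ℝ F (z + a) := fderiv_comp_add_right a

theorem partialDeriv_smooth (hf : IsSmoothSection c f) (v : ℝ × ℝ) (p : ℤ) :
    ContDiff ℝ ∞ (partialDeriv v f p) :=
  ((hf.smooth p).fderiv_right (m := ∞) (by simp)).clm_apply contDiff_const

theorem partialDeriv_periodic (hf : IsSmoothSection c f) (v : ℝ × ℝ) (p : ℤ) (x y : ℝ) :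
    partialDeriv v f p (x, y + 1) = partialDeriv v f p (x, y) := by
  unfold partialDeriv
  have h1 : (fun z : ℝ × ℝ => f p (z + (0, 1))) = f p := by
    ext ⟨x, y⟩
    simpa using hf.periodic p x y
  have h2 := fderiv_translate (f p) (0, 1) (x, y)
  rw [h1] at h2
  rw [h2]
  simp

theorem fderiv_quasiperiodic (hf : IsSmoothSection c f) (k p : ℤ) (x y : ℝ) (v : ℝ × ℝ) :
    partialDeriv v f p (x + k, y) = e (c * k * p * y) * partialDeriv v f p (x, y) +
      (2 * Real.pi * Complex.I * c * k * p * v.2) * (e (c * k * p * y) * f p (x, y)) := by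
  unfold partialDeriv
  have h1 : (fun z : ℝ × ℝ => f p (z + ((k : ℝ), 0))) =
      fun z => e (c * k * p * z.2) * f p z := by
    ext ⟨x, y⟩
    simpa using hf.quasiperiodic k p x y
  have h2 := fderiv_translate (f p) ((k : ℝ), 0) (x, y)
  rw [h1] at h2
  have h3 : (x, y) + ((k : ℝ), (0 : ℝ)) = (x + k, y) := by simp
  rw [h3] at h2
  rw [← h2]
  have h4 : HasFDerivAt (fun z : ℝ × ℝ => e (c * k * p * z.2))
      ((((2 * Real.pi : ℝ) * Complex.I) * e (c * k * p * y)) •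
        (Complex.ofRealCLM.comp ((c * k * p : ℝ) • ContinuousLinearMap.snd ℝ ℝ ℝ))) (x, y) := by
    have h5 : HasFDerivAt (fun z : ℝ × ℝ => (2 * Real.pi * (c * k * p * z.2) : ℝ))
        ((2 * Real.pi) • ((c * k * p : ℝ) • ContinuousLinearMap.snd ℝ ℝ ℝ)) (x, y) :=
      (hasFDerivAt_snd.const_mul _).const_mul _
    have h6 := ((Complex.ofRealCLM.hasFDerivAt.comp (x, y) h5).mul_const Complex.I).cexp
    refine h6.congr_fderiv ?_
    ext <;> simp [e] <;> ring
  have h7 := h4.mul (hf.differentiable p (x, y)).hasFDerivAt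
  have h8 : fderiv ℝ (fun z : ℝ × ℝ => e (c * k * p * z.2) * f p z) (x, y) = _ := h7.fderiv
  rw [h8]
  simp
  ring

theorem partialDeriv_decay (hf : IsSmoothSection c f) (v : ℝ × ℝ) (N k : ℕ) (K : Set (ℝ × ℝ))
    (hK : IsCompact K) : ∃ C : ℝ, ∀ p : ℤ, ∀ z ∈ K,
      |(p : ℝ)| ^ N * ‖iteratedFDeriv ℝ k (partialDeriv v f p) z‖ ≤ C := by
  obtain ⟨C, hC⟩ := hf.decay N (k + 1) K hK
  refine ⟨‖v‖ * C, fun p z hz => ?_⟩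
  have h1 : ‖iteratedFDeriv ℝ k (partialDeriv v f p) z‖ ≤
      ‖v‖ * ‖iteratedFDeriv ℝ (k + 1) (f p) z‖ := by
    have := norm_iteratedFDeriv_clm_apply_const (n := k) (c := v) (x := z) (N := ∞)
      (((hf.smooth p).fderiv_right (m := ∞) (by simp)).contDiffAt) (by exact_mod_cast le_top)
    rwa [norm_iteratedFDeriv_fderiv] at this
  calc |(p : ℝ)| ^ N * ‖iteratedFDeriv ℝ k (partialDeriv v f p) z‖
      ≤ |(p : ℝ)| ^ N * (‖v‖ * ‖iteratedFDeriv ℝ (k + 1) (f p) z‖) := by gcongr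
    _ = ‖v‖ * (|(p : ℝ)| ^ N * ‖iteratedFDeriv ℝ (k + 1) (f p) z‖) := by ring
    _ ≤ ‖v‖ * C := by gcongr; exact hC p z hz

/-- Multiplication with a smooth function of `(x, y)` and powers of `p` preserves decay. -/
theorem decay_mul (hf : IsSmoothSection c f) {F : ℝ × ℝ → ℂ} (hF : ContDiff ℝ ∞ F) (N k : ℕ)
    (K : Set (ℝ × ℝ)) (hK : IsCompact K) : ∃ C : ℝ, ∀ p : ℤ, ∀ z ∈ K,
      |(p : ℝ)| ^ N * ‖iteratedFDeriv ℝ k (fun z => (p : ℂ) * (F z * f p z)) z‖ ≤ C := by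
  have hb : ∀ i, ∃ B : ℝ, 0 ≤ B ∧ ∀ z ∈ K, ‖iteratedFDeriv ℝ i F z‖ ≤ B := fun i => by
    obtain ⟨B, hB⟩ := hK.exists_bound_of_continuousOn
      (hF.continuous_iteratedFDeriv (m := i) (by exact_mod_cast le_top)).continuousOn
    exact ⟨max B 0, le_max_right _ _, fun z hz => (hB z hz).trans (le_max_left _ _)⟩
  choose B hB0 hB using hb
  choose C hC using fun j => hf.decay (N + 1) j K hK
  refine ⟨∑ i ∈ Finset.range (k + 1), (k.choose i : ℝ) * B i * C (k - i), fun p z hz => ?_⟩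
  have h0 : ContDiff ℝ ∞ (fun z => F z * f p z) := hF.mul (hf.smooth p)
  have h1 := norm_iteratedFDeriv_mul_le hF (hf.smooth p) z (n := k) (by exact_mod_cast le_top)
  have h2 : iteratedFDeriv ℝ k (fun z => (p : ℂ) * (F z * f p z)) z =
      (p : ℂ) • iteratedFDeriv ℝ k (fun z => F z * f p z) z :=
    iteratedFDeriv_const_smul_apply (a := (p : ℂ)) (f := fun z => F z * f p z)
      (h0.contDiffAt.of_le (by exact_mod_cast le_top))
  rw [h2, norm_smul, Complex.norm_intCast, ← mul_assoc, ← pow_succ]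
  calc |(p : ℝ)| ^ (N + 1) * ‖iteratedFDeriv ℝ k (fun z => F z * f p z) z‖
      ≤ |(p : ℝ)| ^ (N + 1) * ∑ i ∈ Finset.range (k + 1), (k.choose i : ℝ) *
          ‖iteratedFDeriv ℝ i F z‖ * ‖iteratedFDeriv ℝ (k - i) (f p) z‖ := by gcongr
    _ = ∑ i ∈ Finset.range (k + 1), (k.choose i : ℝ) * ‖iteratedFDeriv ℝ i F z‖ *
          (|(p : ℝ)| ^ (N + 1) * ‖iteratedFDeriv ℝ (k - i) (f p) z‖) := by
        rw [Finset.mul_sum]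
        exact Finset.sum_congr rfl fun i _ => by ring
    _ ≤ _ := by
        refine Finset.sum_le_sum fun i _ => ?_
        have := hB0 i
        gcongr
        · exact hB i z hz
        · exact hC (k - i) p z hz

theorem IsSmoothSection.d1 (hf : IsSmoothSection c f) : IsSmoothSection c (d1Fun f) where
  smooth p := (partialDeriv_smooth hf _ p).neg
  periodic p x y := by simp only [d1Fun, partialDeriv_periodic hf]
  quasiperiodic k p x y := by
    simp only [d1Fun, fderiv_quasiperiodic hf]
    simp
  decay N k K hK := by
    obtain ⟨C, hC⟩ := partialDeriv_decay hf (1, 0) N k K hK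
    refine ⟨C, fun p z hz => ?_⟩
    have h1 : d1Fun f p = -partialDeriv (1, 0) f p := rfl
    rw [h1, iteratedFDeriv_neg_apply, norm_neg]
    exact hC p z hz

theorem contDiff_ofReal_fst : ContDiff ℝ ∞ (fun z : ℝ × ℝ => (z.1 : ℂ)) :=
  Complex.ofRealCLM.contDiff.comp contDiff_fst

theorem IsSmoothSection.d2 (hf : IsSmoothSection c f) : IsSmoothSection c (d2Fun c f) where
  smooth p := ((contDiff_const.mul contDiff_ofReal_fst).mul (hf.smooth p)).sub
    (partialDeriv_smooth hf _ p)
  periodic p x y := by simp only [d2Fun, partialDeriv_periodic hf, hf.periodic]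
  quasiperiodic k p x y := by
    simp only [d2Fun, fderiv_quasiperiodic hf, hf.quasiperiodic]
    push_cast
    ring
  decay N k K hK := by
    have hF : ContDiff ℝ ∞ (fun z : ℝ × ℝ => 2 * Real.pi * Complex.I * c * (z.1 : ℂ)) :=
      contDiff_const.mul contDiff_ofReal_fst
    obtain ⟨C, hC⟩ := partialDeriv_decay hf (0, 1) N k K hK
    obtain ⟨D, hD⟩ := decay_mul hf hF N k K hK
    refine ⟨D + C, fun p z hz => ?_⟩
    have h1 : d2Fun c f p = (fun z : ℝ × ℝ => (p : ℂ) *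
        (2 * Real.pi * Complex.I * c * (z.1 : ℂ) * f p z)) - partialDeriv (0, 1) f p := by
      ext z
      simp only [d2Fun, Pi.sub_apply]
      ring
    have h2 : ContDiff ℝ ∞ (fun z : ℝ × ℝ => (p : ℂ) *
        (2 * Real.pi * Complex.I * c * (z.1 : ℂ) * f p z)) :=
      contDiff_const.mul (hF.mul (hf.smooth p))
    rw [h1, iteratedFDeriv_sub_apply (h2.contDiffAt.of_le (by exact_mod_cast le_top))
      ((partialDeriv_smooth hf _ p).contDiffAt.of_le (by exact_mod_cast le_top))]
    calc _ ≤ |(p : ℝ)| ^ N * (‖iteratedFDeriv ℝ k (fun z : ℝ × ℝ => (p : ℂ) *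
            (2 * Real.pi * Complex.I * c * (z.1 : ℂ) * f p z)) z‖ +
            ‖iteratedFDeriv ℝ k (partialDeriv (0, 1) f p) z‖) := by
          gcongr
          exact norm_sub_le _ _
      _ ≤ _ := by rw [mul_add]; exact add_le_add (hD p z hz) (hC p z hz)

theorem IsSmoothSection.d3 (alpha : ℝ) (hf : IsSmoothSection c f) :
    IsSmoothSection c (d3Fun c alpha f) where
  smooth p := contDiff_const.mul (hf.smooth p)
  periodic p x y := by simp only [d3Fun, hf.periodic]
  quasiperiodic k p x y := by
    simp only [d3Fun, hf.quasiperiodic]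
    ring
  decay N k K hK := by
    have hF : ContDiff ℝ ∞ (fun _ : ℝ × ℝ => 2 * Real.pi * Complex.I * c * (alpha : ℂ)) :=
      contDiff_const
    obtain ⟨D, hD⟩ := decay_mul hf hF N k K hK
    refine ⟨D, fun p z hz => ?_⟩
    have h1 : d3Fun c alpha f p = fun z : ℝ × ℝ => (p : ℂ) *
        (2 * Real.pi * Complex.I * c * (alpha : ℂ) * f p z) := by
      ext z
      simp only [d3Fun]
      ring
    rw [h1]
    exact hD p z hz

/-- Term-by-term differentiation of the product. -/
theorem partialDeriv_starMul (hf : IsSmoothSection c f) (hg : IsSmoothSection c g) (v : ℝ × ℝ)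
    (p : ℤ) (z : ℝ × ℝ) :
    partialDeriv v (starMul h mu nu f g) p z =
      ∑' q, (partialDeriv v f q (z - step h mu nu (q - p)) * g (p - q) (z - step h mu nu q) +
        f q (z - step h mu nu (q - p)) * partialDeriv v g (p - q) (z - step h mu nu q)) := by
  have h1 : ∀ q, fderiv ℝ (mulTerm h mu nu f g p q) z v =
      partialDeriv v f q (z - step h mu nu (q - p)) * g (p - q) (z - step h mu nu q) +
        f q (z - step h mu nu (q - p)) * partialDeriv v g (p - q) (z - step h mu nu q) := by
    intro q
    have h2 : HasFDerivAt (fun z => f q (z - step h mu nu (q - p)))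
        (fderiv ℝ (f q) (z - step h mu nu (q - p))) z := by
      have := (hf.differentiable q (z - step h mu nu (q - p))).hasFDerivAt
      exact (hasFDerivAt_comp_sub _).mpr this
    have h3 : HasFDerivAt (fun z => g (p - q) (z - step h mu nu q))
        (fderiv ℝ (g (p - q)) (z - step h mu nu q)) z := by
      have := (hg.differentiable (p - q) (z - step h mu nu q)).hasFDerivAt
      exact (hasFDerivAt_comp_sub _).mpr this
    have h4 := h2.mul h3
    have h5 : fderiv ℝ (mulTerm h mu nu f g p q) z = _ := h4.fderiv
    rw [h5]
    simp only [add_apply, smul_apply, smul_eq_mul, partialDeriv]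
    ring
  have hb : ∀ R : ℝ, ∃ v : ℤ → ℝ, Summable v ∧ ∀ q z, ‖z‖ < R →
      ‖fderiv ℝ (mulTerm h mu nu f g p q) z‖ ≤ v q := fun R => by
    obtain ⟨C, -, hC⟩ := mulTerm_bound (h := h) (mu := mu) (nu := nu) hf hg 0 1 R
    refine ⟨_, summable_inv_sq.mul_left C, fun q z hz => ?_⟩
    have := hC p q z hz.le
    rw [norm_iteratedFDeriv_one] at this
    simpa using this
  have h6 := hasFDerivAt_tsum_local
    (fun q => (contDiff_mulTerm (h := h) (mu := mu) (nu := nu) hf hg p q).differentiable (by simp))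
    (summable_mulTerm hf hg p) hb z
  have h7 : Summable fun q => fderiv ℝ (mulTerm h mu nu f g p q) z := by
    obtain ⟨w, hw, hwb⟩ := hb (‖z‖ + 1)
    exact Summable.of_norm_bounded hw fun q => hwb q z (by simp)
  have h8 : partialDeriv v (starMul h mu nu f g) p z =
      (∑' q, fderiv ℝ (mulTerm h mu nu f g p q) z) v := by
    unfold partialDeriv
    exact congrArg (fun L : ℝ × ℝ →L[ℝ] ℂ => L v) h6.fderiv
  rw [h8]
  have h9 := (ContinuousLinearMap.apply ℝ ℂ v).map_tsum h7
  simp only [ContinuousLinearMap.apply_apply] at h9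
  rw [h9]
  exact tsum_congr h1

namespace SmoothAlgebra

/-- The derivation `d₁` of the smooth algebra. -/
def d1 : SmoothAlgebra c h mu nu →ₗ[ℂ] SmoothAlgebra c h mu nu where
  toFun a := mk (d1Fun a.fn) a.isSmoothSection.d1
  map_add' a b := ext fun p z => by
    simp only [fn_mk, d1Fun, partialDeriv, fn_add, Pi.add_apply]
    rw [fderiv_add (a.isSmoothSection.differentiable p z) (b.isSmoothSection.differentiable p z)]
    simp only [add_apply]
    ring
  map_smul' r a := ext fun p z => by
    simp only [fn_mk, d1Fun, partialDeriv, fn_smul, Pi.smul_apply]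
    rw [fderiv_const_smul (a.isSmoothSection.differentiable p z)]
    simp

/-- The derivation `d₂` of the smooth algebra. -/
def d2 : SmoothAlgebra c h mu nu →ₗ[ℂ] SmoothAlgebra c h mu nu where
  toFun a := mk (d2Fun c a.fn) a.isSmoothSection.d2
  map_add' a b := ext fun p z => by
    simp only [fn_mk, d2Fun, partialDeriv, fn_add, Pi.add_apply]
    rw [fderiv_add (a.isSmoothSection.differentiable p z) (b.isSmoothSection.differentiable p z)]
    simp only [add_apply]
    ring
  map_smul' r a := ext fun p z => by
    simp only [fn_mk, d2Fun, partialDeriv, fn_smul, Pi.smul_apply]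
    rw [fderiv_const_smul (a.isSmoothSection.differentiable p z)]
    simp
    ring

/-- The derivation `d₃` of the smooth algebra. -/
def d3 (alpha : ℝ) : SmoothAlgebra c h mu nu →ₗ[ℂ] SmoothAlgebra c h mu nu where
  toFun a := mk (d3Fun c alpha a.fn) (a.isSmoothSection.d3 alpha)
  map_add' a b := ext fun p z => by
    simp only [fn_mk, d3Fun, fn_add, Pi.add_apply]
    ring
  map_smul' r a := ext fun p z => by
    simp only [fn_mk, d3Fun, fn_smul, Pi.smul_apply, smul_eq_mul, RingHom.id_apply]
    ring

/-- The derivations `d₁, d₂, d₃` (indexed by `0, 1, 2`). -/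
def d (alpha : ℝ) : Fin 3 → SmoothAlgebra c h mu nu →ₗ[ℂ] SmoothAlgebra c h mu nu :=
  ![d1, d2, d3 alpha]

/-- The derivations `δ_j = i d_j`. -/
def delta (alpha : ℝ) (j : Fin 3) : SmoothAlgebra c h mu nu →ₗ[ℂ] SmoothAlgebra c h mu nu :=
  Complex.I • d alpha j

theorem d1_mul (a b : SmoothAlgebra c h mu nu) : d1 (a * b) = d1 a * b + a * d1 b := by
  refine ext fun p z => ?_
  have h1 := (summable_term (d1 a) b p z).tsum_add (summable_term a (d1 b) p z)
  change -partialDeriv (1, 0) (starMul h mu nu a.fn b.fn) p z =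
    (∑' q, mulTerm h mu nu (d1 a).fn b.fn p q z) + ∑' q, mulTerm h mu nu a.fn (d1 b).fn p q z
  rw [← h1, partialDeriv_starMul a.isSmoothSection b.isSmoothSection, ← tsum_neg]
  refine tsum_congr fun q => ?_
  simp only [mulTerm, d1, LinearMap.coe_mk, AddHom.coe_mk, fn_mk, d1Fun]
  ring

theorem d3_mul (alpha : ℝ) (a b : SmoothAlgebra c h mu nu) :
    d3 alpha (a * b) = d3 alpha a * b + a * d3 alpha b := by
  refine ext fun p z => ?_
  have h1 := (summable_term (d3 alpha a) b p z).tsum_add (summable_term a (d3 alpha b) p z)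
  change d3Fun c alpha (starMul h mu nu a.fn b.fn) p z =
    (∑' q, mulTerm h mu nu (d3 alpha a).fn b.fn p q z) +
      ∑' q, mulTerm h mu nu a.fn (d3 alpha b).fn p q z
  rw [← h1, d3Fun, starMul, ← tsum_mul_left]
  refine tsum_congr fun q => ?_
  simp only [mulTerm, d3, LinearMap.coe_mk, AddHom.coe_mk, fn_mk, d3Fun]
  push_cast
  ring

theorem d2_mul (a b : SmoothAlgebra c h mu nu) : d2 (a * b) = d2 a * b + a * d2 b := by
  refine ext fun p z => ?_
  have h1 := (summable_term (d2 a) b p z).tsum_add (summable_term a (d2 b) p z)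
  change 2 * Real.pi * Complex.I * c * p * z.1 * starMul h mu nu a.fn b.fn p z -
      partialDeriv (0, 1) (starMul h mu nu a.fn b.fn) p z =
    (∑' q, mulTerm h mu nu (d2 a).fn b.fn p q z) + ∑' q, mulTerm h mu nu a.fn (d2 b).fn p q z
  have h2 : ∀ q, mulTerm h mu nu (d2 a).fn b.fn p q z + mulTerm h mu nu a.fn (d2 b).fn p q z =
      2 * Real.pi * Complex.I * c * p * z.1 * mulTerm h mu nu a.fn b.fn p q z -
      (partialDeriv (0, 1) a.fn q (z - step h mu nu (q - p)) * b.fn (p - q) (z - step h mu nu q) +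
        a.fn q (z - step h mu nu (q - p)) *
          partialDeriv (0, 1) b.fn (p - q) (z - step h mu nu q)) := by
    intro q
    simp only [mulTerm, d2, LinearMap.coe_mk, AddHom.coe_mk, fn_mk, d2Fun, step, Prod.fst_sub]
    push_cast
    ring
  have h3 : Summable fun q => 2 * Real.pi * Complex.I * c * p * z.1 *
      mulTerm h mu nu a.fn b.fn p q z := (summable_term a b p z).mul_left _
  have h4 := (summable_term (d2 a) b p z).add (summable_term a (d2 b) p z)
  simp only [h2] at h4
  have h5 := h3.sub h4
  simp only [sub_sub_cancel] at h5
  rw [← h1, tsum_congr h2, h3.tsum_sub h5, starMul, tsum_mul_left,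
    partialDeriv_starMul a.isSmoothSection b.isSmoothSection]

theorem delta_mul (alpha : ℝ) (j : Fin 3) (a b : SmoothAlgebra c h mu nu) :
    delta alpha j (a * b) = delta alpha j a * b + a * delta alpha j b := by
  have h1 : d alpha j (a * b) = d alpha j a * b + a * d alpha j b := by
    fin_cases j
    · exact d1_mul a b
    · exact d2_mul a b
    · exact d3_mul alpha a b
  simp only [delta, LinearMap.smul_apply, h1, smul_add, smul_mul_assoc, mul_smul_comm]

end SmoothAlgebra


/-- The unit square `(0, 1] × (0, 1]`, a fundamental domain for `[0, 1] × 𝕋`. -/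
def unitSquare : Set (ℝ × ℝ) := Set.Ioc 0 1 ×ˢ Set.Ioc 0 1

theorem measurableSet_unitSquare : MeasurableSet unitSquare :=
  measurableSet_Ioc.prod measurableSet_Ioc

theorem lintegral_periodic_translate {G : ℝ → ENNReal} (hG : Measurable G)
    (hp : ∀ x, G (x + 1) = G x) (t : ℝ) :
    ∫⁻ x in Set.Ioc (0 : ℝ) 1, G (x - t) = ∫⁻ x in Set.Ioc (0 : ℝ) 1, G x := by
  have h1 : ∫⁻ x in Set.Ioc (0 : ℝ) 1, G (x - t) = ∫⁻ x in Set.Ioc (-t) (-t + 1), G x := by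
    have h2 := (MeasureTheory.measurePreserving_sub_right MeasureTheory.volume t).setLIntegral_comp_preimage
      (measurableSet_Ioc (a := -t) (b := -t + 1)) hG
    rw [← h2]
    congr 2
    ext x
    simp only [Set.mem_Ioc, Set.mem_preimage]
    constructor <;> rintro ⟨h3, h4⟩ <;> constructor <;> linarith
  have h3 : MeasureTheory.VAddInvariantMeasure (AddSubgroup.zmultiples (1 : ℝ)) ℝ
      MeasureTheory.volume := ⟨fun c s _ => MeasureTheory.measure_preimage_add _ _ _⟩
  have h4 : Function.Periodic G 1 := hp
  have h5 := MeasureTheory.IsAddFundamentalDomain.setLIntegral_eq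
    (G := AddSubgroup.zmultiples (1 : ℝ)) (isAddFundamentalDomain_Ioc one_pos (-t))
    (isAddFundamentalDomain_Ioc one_pos 0) G h4.map_vadd_zmultiples
  rw [h1, h5, zero_add]

theorem lintegral_square_translate {F : ℝ × ℝ → ENNReal} (hF : Measurable F)
    (hx : ∀ x y, F (x + 1, y) = F (x, y)) (hy : ∀ x y, F (x, y + 1) = F (x, y)) (v : ℝ × ℝ) :
    ∫⁻ z in unitSquare, F (z - v) = ∫⁻ z in unitSquare, F z := by
  unfold unitSquare
  rw [MeasureTheory.Measure.volume_eq_prod, ← MeasureTheory.Measure.prod_restrict,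
    MeasureTheory.lintegral_prod (fun z => F (z - v))
      (hF.comp (measurable_id.sub_const v)).aemeasurable,
    MeasureTheory.lintegral_prod _ hF.aemeasurable]
  have h1 : ∀ x : ℝ, ∫⁻ y in Set.Ioc (0 : ℝ) 1, F ((x, y) - v) =
      ∫⁻ y in Set.Ioc (0 : ℝ) 1, F (x - v.1, y) := fun x =>
    lintegral_periodic_translate (G := fun y => F (x - v.1, y)) (hF.comp (by fun_prop))
      (fun y => hy _ y) v.2
  simp_rw [h1]
  exact lintegral_periodic_translate (G := fun x => ∫⁻ y in Set.Ioc (0 : ℝ) 1, F (x, y))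
    hF.lintegral_prod_right' (fun x => by simp_rw [hx]) v.1

namespace SmoothAlgebra

variable {c : ℕ} {h mu nu : ℝ}

theorem continuous_fn (a : SmoothAlgebra c h mu nu) (p : ℤ) : Continuous (a.fn p) :=
  (a.isSmoothSection.smooth p).continuous

theorem norm_fn_add_one_fst (a : SmoothAlgebra c h mu nu) (p : ℤ) (x y : ℝ) :
    ‖a.fn p (x + 1, y)‖ = ‖a.fn p (x, y)‖ := by
  have := a.isSmoothSection.quasiperiodic 1 p x y
  rw [Int.cast_one] at this
  rw [this, norm_mul, norm_e, one_mul]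

/-- The trace `τ(a) = ∫_0^1 ∫_𝕋 a(x, y, 0) dx dy`. -/
def trace (a : SmoothAlgebra c h mu nu) : ℂ := ∫ z in unitSquare, a.fn 0 z

theorem integrable_fn (a : SmoothAlgebra c h mu nu) (p : ℤ) :
    MeasureTheory.IntegrableOn (a.fn p) unitSquare := by
  refine ((a.continuous_fn p).continuousOn.integrableOn_compact
    (K := Set.Icc 0 1 ×ˢ Set.Icc 0 1) (isCompact_Icc.prod isCompact_Icc)).mono_set ?_
  exact Set.prod_mono Set.Ioc_subset_Icc_self Set.Ioc_subset_Icc_self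

theorem trace_add (a b : SmoothAlgebra c h mu nu) : trace (a + b) = trace a + trace b :=
  MeasureTheory.integral_add (a.integrable_fn 0) (b.integrable_fn 0)

theorem trace_smul (r : ℂ) (a : SmoothAlgebra c h mu nu) : trace (r • a) = r * trace a :=
  MeasureTheory.integral_const_mul r _

theorem trace_star (a : SmoothAlgebra c h mu nu) :
    trace (star a) = (starRingEnd ℂ) (trace a) := by
  unfold trace
  rw [← integral_conj]
  simp [fn_star, starConj]

theorem hasSum_star_mul_self (a : SmoothAlgebra c h mu nu) (z : ℝ × ℝ) :
    HasSum (fun q : ℤ => ((‖a.fn (-q) (z - step h mu nu q)‖ ^ 2 : ℝ) : ℂ))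
      ((star a * a).fn 0 z) := by
  have h1 := (summable_term (star a) a 0 z).hasSum
  have h2 : ∀ q, mulTerm h mu nu (star a).fn a.fn 0 q z =
      ((‖a.fn (-q) (z - step h mu nu q)‖ ^ 2 : ℝ) : ℂ) := fun q => by
    simp only [mulTerm, fn_star, starConj, sub_zero, zero_sub]
    rw [Complex.conj_mul']
    push_cast
    rfl
  have h3 : (star a * a).fn 0 z = ∑' q, mulTerm h mu nu (star a).fn a.fn 0 q z := rfl
  rw [h3]
  simp_rw [h2] at h1 ⊢
  exact h1

theorem star_mul_self_eq_ofReal (a : SmoothAlgebra c h mu nu) (z : ℝ × ℝ) :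
    (star a * a).fn 0 z = ((∑' q : ℤ, ‖a.fn (-q) (z - step h mu nu q)‖ ^ 2 : ℝ) : ℂ) := by
  rw [← (hasSum_star_mul_self a z).tsum_eq, Complex.ofReal_tsum]

theorem summable_sq (a : SmoothAlgebra c h mu nu) (z : ℝ × ℝ) :
    Summable fun q : ℤ => ‖a.fn (-q) (z - step h mu nu q)‖ ^ 2 :=
  Complex.summable_ofReal.mp (hasSum_star_mul_self a z).summable

theorem re_star_mul_self_nonneg (a : SmoothAlgebra c h mu nu) (z : ℝ × ℝ) :
    0 ≤ ((star a * a).fn 0 z).re := by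
  rw [star_mul_self_eq_ofReal, Complex.ofReal_re]
  exact tsum_nonneg fun q => by positivity

theorem re_trace (a : SmoothAlgebra c h mu nu) :
    (trace a).re = ∫ z in unitSquare, (a.fn 0 z).re :=
  (integral_re (a.integrable_fn 0)).symm

/-- The squared `L²`-norm, as an extended nonnegative number. -/
def normSq (a : SmoothAlgebra c h mu nu) : ENNReal :=
  ∑' p : ℤ, ∫⁻ z in unitSquare, ‖a.fn p z‖ₑ ^ 2

theorem measurable_sq (a : SmoothAlgebra c h mu nu) (p : ℤ) :
    Measurable fun z => ‖a.fn p z‖ₑ ^ 2 :=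
  (a.continuous_fn p).measurable.enorm.pow_const 2

theorem lintegral_sq_translate (a : SmoothAlgebra c h mu nu) (p : ℤ) (v : ℝ × ℝ) :
    ∫⁻ z in unitSquare, ‖a.fn p (z - v)‖ₑ ^ 2 = ∫⁻ z in unitSquare, ‖a.fn p z‖ₑ ^ 2 := by
  refine lintegral_square_translate (F := fun z => ‖a.fn p z‖ₑ ^ 2) (measurable_sq a p)
    (fun x y => ?_) (fun x y => ?_) v
  · simp only [← ofReal_norm, norm_fn_add_one_fst]
  · simp only [a.isSmoothSection.periodic]

theorem ofReal_re_trace_star_mul_self (a : SmoothAlgebra c h mu nu) :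
    ENNReal.ofReal (trace (star a * a)).re = normSq a := by
  rw [re_trace, MeasureTheory.ofReal_integral_eq_lintegral_ofReal
    (f := fun z => ((star a * a).fn 0 z).re)
    ((star a * a).integrable_fn 0).re (Filter.Eventually.of_forall (re_star_mul_self_nonneg a))]
  have h1 : ∀ z, ENNReal.ofReal ((star a * a).fn 0 z).re =
      ∑' q : ℤ, ‖a.fn (-q) (z - step h mu nu q)‖ₑ ^ 2 := fun z => by
    rw [star_mul_self_eq_ofReal, Complex.ofReal_re,
      ENNReal.ofReal_tsum_of_nonneg (fun q => by positivity) (summable_sq a z)]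
    refine tsum_congr fun q => ?_
    rw [ENNReal.ofReal_pow (norm_nonneg _), ofReal_norm]
  simp_rw [h1]
  rw [MeasureTheory.lintegral_tsum (f := fun q z => ‖a.fn (-q) (z - step h mu nu q)‖ₑ ^ 2) fun q =>
    ((measurable_sq a (-q)).comp (measurable_id.sub_const (step h mu nu q))).aemeasurable]
  simp_rw [lintegral_sq_translate]
  exact (Equiv.neg ℤ).tsum_eq fun p => ∫⁻ z in unitSquare, ‖a.fn p z‖ₑ ^ 2

theorem tsum_mul_sq_le (A β : ℤ → ENNReal) :
    (∑' r, A r * β r) ^ 2 ≤ (∑' r, A r) * ∑' r, A r * β r ^ 2 := by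
  have h0 : ∀ x y : ENNReal, 2 * (x * y) ≤ x ^ 2 + y ^ 2 := fun x y => by
    rcases le_total x y with hxy | hxy
    · obtain ⟨d, rfl⟩ := exists_add_of_le hxy
      calc 2 * (x * (x + d)) ≤ 2 * (x * (x + d)) + d ^ 2 := le_self_add
        _ = _ := by ring
    · obtain ⟨d, rfl⟩ := exists_add_of_le hxy
      calc 2 * ((y + d) * y) ≤ 2 * ((y + d) * y) + d ^ 2 := le_self_add
        _ = _ := by ring
  have h1 : (∑' r, A r * β r) ^ 2 = ∑' r, ∑' s, A r * A s * (β r * β s) := by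
    rw [sq, ← ENNReal.tsum_mul_right]
    refine tsum_congr fun r => ?_
    rw [← ENNReal.tsum_mul_left]
    exact tsum_congr fun s => by ring
  have h2 : (∑' r, A r) * ∑' r, A r * β r ^ 2 = ∑' r, ∑' s, A r * A s * β s ^ 2 := by
    rw [← ENNReal.tsum_mul_right]
    refine tsum_congr fun r => ?_
    rw [← ENNReal.tsum_mul_left]
    exact tsum_congr fun s => by ring
  have h3 : (∑' r, A r) * ∑' r, A r * β r ^ 2 = ∑' r, ∑' s, A r * A s * β r ^ 2 := by
    rw [h2, ENNReal.tsum_comm]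
    exact tsum_congr fun s => tsum_congr fun r => by ring
  have h4 : 2 * (∑' r, A r * β r) ^ 2 ≤ 2 * ((∑' r, A r) * ∑' r, A r * β r ^ 2) := by
    rw [two_mul ((∑' r, A r) * _)]
    nth_rewrite 1 [h3]
    rw [h2, h1, ← ENNReal.tsum_mul_left, ← ENNReal.tsum_add]
    refine ENNReal.tsum_le_tsum fun r => ?_
    rw [← ENNReal.tsum_mul_left, ← ENNReal.tsum_add]
    refine ENNReal.tsum_le_tsum fun s => ?_
    calc 2 * (A r * A s * (β r * β s)) = A r * A s * (2 * (β r * β s)) := by ring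
      _ ≤ A r * A s * (β r ^ 2 + β s ^ 2) := by gcongr; exact h0 _ _
      _ = _ := by ring
  exact (ENNReal.mul_le_mul_iff_right (by norm_num) (by norm_num)).mp h4

/-- Left multiplication is bounded for the `L²`-norm. -/
theorem normSq_mul_le (a : SmoothAlgebra c h mu nu) :
    ∃ C : ℝ, 0 ≤ C ∧ ∀ u : SmoothAlgebra c h mu nu,
      normSq (a * u) ≤ ENNReal.ofReal C * ENNReal.ofReal C * normSq u := by
  obtain ⟨A, hA, hA0, hAb⟩ := exists_bound a
  refine ⟨∑' q, A q, tsum_nonneg hA0, fun u => ?_⟩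
  rw [ENNReal.ofReal_tsum_of_nonneg hA0 hA]
  set A' : ℤ → ENNReal := fun q => ENNReal.ofReal (A q) with hA'
  have h1 : ∀ p z, ‖(a * u).fn p z‖ₑ ^ 2 ≤
      (∑' r, A' r) * ∑' r, A' r * ‖u.fn (p - r) (z - step h mu nu r)‖ₑ ^ 2 := fun p z => by
    refine le_trans ?_ (tsum_mul_sq_le A' _)
    gcongr
    rw [fn_mul, starMul]
    refine (enorm_tsum_le_tsum_enorm).trans ?_
    refine ENNReal.tsum_le_tsum fun r => ?_
    rw [mulTerm, enorm_mul]
    gcongr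
    rw [← ofReal_norm]
    exact ENNReal.ofReal_le_ofReal (hAb _ _)
  have hm : ∀ p r, Measurable fun z => ‖u.fn (p - r) (z - step h mu nu r)‖ₑ ^ 2 := fun p r =>
    (measurable_sq u (p - r)).comp (measurable_id.sub_const (step h mu nu r))
  calc normSq (a * u)
      ≤ ∑' p : ℤ, ∫⁻ z in unitSquare,
          (∑' r, A' r) * ∑' r, A' r * ‖u.fn (p - r) (z - step h mu nu r)‖ₑ ^ 2 :=
        ENNReal.tsum_le_tsum fun p => MeasureTheory.lintegral_mono fun z => h1 p z
    _ = (∑' r, A' r) * ∑' p : ℤ, ∑' r, A' r *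
          ∫⁻ z in unitSquare, ‖u.fn (p - r) z‖ₑ ^ 2 := by
        rw [← ENNReal.tsum_mul_left]
        refine tsum_congr fun p => ?_
        rw [MeasureTheory.lintegral_const_mul _
          (Measurable.tsum fun r => (hm p r).const_mul _),
          MeasureTheory.lintegral_tsum fun r => ((hm p r).const_mul _).aemeasurable]
        congr 1
        refine tsum_congr fun r => ?_
        rw [MeasureTheory.lintegral_const_mul _ (hm p r), lintegral_sq_translate]
    _ = (∑' r, A' r) * ∑' r, A' r * normSq u := by
        rw [ENNReal.tsum_comm]
        congr 1
        refine tsum_congr fun r => ?_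
        rw [ENNReal.tsum_mul_left]
        congr 1
        exact (Equiv.subRight r).tsum_eq fun p => ∫⁻ z in unitSquare, ‖u.fn p z‖ₑ ^ 2
    _ = _ := by rw [ENNReal.tsum_mul_right, mul_assoc]

theorem eq_zero_of_trace_eq_zero (a : SmoothAlgebra c h mu nu)
    (ha : trace (star a * a) = 0) : a = 0 := by
  have h1 : normSq a = 0 := by
    rw [← ofReal_re_trace_star_mul_self, ha]
    simp
  refine ext fun p z => ?_
  have h2 : ∫⁻ z in unitSquare, ‖a.fn p z‖ₑ ^ 2 = 0 := ENNReal.tsum_eq_zero.mp h1 p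
  rw [MeasureTheory.lintegral_eq_zero_iff (measurable_sq a p)] at h2
  have h3 : Set.EqOn (a.fn p) 0 (Set.Ioo 0 1 ×ˢ Set.Ioo 0 1) := by
    refine MeasureTheory.Measure.eqOn_open_of_ae_eq (μ := MeasureTheory.volume) ?_
      (isOpen_Ioo.prod isOpen_Ioo) (a.continuous_fn p).continuousOn continuousOn_const
    have h4 := MeasureTheory.ae_restrict_of_ae_restrict_of_subset
      (Set.prod_mono Set.Ioo_subset_Ioc_self Set.Ioo_subset_Ioc_self :
        (Set.Ioo (0 : ℝ) 1 ×ˢ Set.Ioo (0 : ℝ) 1) ⊆ unitSquare) h2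
    filter_upwards [h4] with w hw
    simpa using hw
  have h5 : Set.EqOn (a.fn p) 0 (Set.Icc 0 1 ×ˢ Set.Icc 0 1) := by
    have := h3.closure (a.continuous_fn p) continuous_const
    rwa [closure_prod_eq, closure_Ioo zero_ne_one] at this
  have h6 := a.isSmoothSection.quasiperiodic ⌊z.1⌋ p (z.1 - ⌊z.1⌋) z.2
  have h7 := periodic_int (g := fun y => a.fn p (z.1 - ⌊z.1⌋, y))
    (fun y => a.isSmoothSection.periodic p _ y) ⌊z.2⌋ (z.2 - ⌊z.2⌋)
  have h8 : a.fn p (z.1 - ⌊z.1⌋, z.2 - ⌊z.2⌋) = 0 := by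
    refine h5 ⟨⟨?_, ?_⟩, ⟨?_, ?_⟩⟩
    · linarith [Int.floor_le z.1]
    · linarith [Int.lt_floor_add_one z.1]
    · linarith [Int.floor_le z.2]
    · linarith [Int.lt_floor_add_one z.2]
  simp only [sub_add_cancel] at h6 h7
  rw [← h7] at h8
  rw [h8, mul_zero] at h6
  exact h6

end SmoothAlgebra


/-- The smooth algebra, regarded as a pre-Hilbert space with `⟨a, b⟩ = τ(a^* b)`. -/
def PreL2 (c : ℕ) (h mu nu : ℝ) : Type := SmoothAlgebra c h mu nu

section

variable {c : ℕ} {h mu nu : ℝ}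

instance : AddCommGroup (PreL2 c h mu nu) := inferInstanceAs (AddCommGroup (SmoothAlgebra c h mu nu))

instance : Module ℂ (PreL2 c h mu nu) := inferInstanceAs (Module ℂ (SmoothAlgebra c h mu nu))

/-- The identity map from the smooth algebra to the pre-Hilbert space. -/
def toPreL2 : SmoothAlgebra c h mu nu ≃ₗ[ℂ] PreL2 c h mu nu := LinearEquiv.refl ℂ _

/-- The inner product `⟨a, b⟩ = τ(a^* b)`. -/
abbrev innerCore : InnerProductSpace.Core ℂ (PreL2 c h mu nu) where
  inner a b := SmoothAlgebra.trace (star (toPreL2.symm a) * toPreL2.symm b)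
  conj_inner_symm a b := by rw [← SmoothAlgebra.trace_star, star_mul, star_star]
  re_inner_nonneg a := by
    change 0 ≤ (SmoothAlgebra.trace (star (toPreL2.symm a) * toPreL2.symm a)).re
    rw [SmoothAlgebra.re_trace]
    exact MeasureTheory.integral_nonneg (SmoothAlgebra.re_star_mul_self_nonneg _)
  add_left a b d := by rw [map_add, star_add, add_mul, SmoothAlgebra.trace_add]
  smul_left a b r := by
    rw [map_smul, star_smul, smul_mul_assoc, SmoothAlgebra.trace_smul]
    rfl
  definite a ha := toPreL2.symm.injective
    ((SmoothAlgebra.eq_zero_of_trace_eq_zero _ ha).trans (map_zero toPreL2.symm).symm)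

instance : NormedAddCommGroup (PreL2 c h mu nu) :=
  InnerProductSpace.Core.toNormedAddCommGroup (cd := innerCore)

instance : InnerProductSpace ℂ (PreL2 c h mu nu) :=
  InnerProductSpace.ofCore innerCore.toCore

theorem inner_toPreL2 (a b : SmoothAlgebra c h mu nu) :
    inner ℂ (toPreL2 a) (toPreL2 b) = SmoothAlgebra.trace (star a * b) := rfl

end

/-- The Hilbert space `L²(𝒜^∞_ħ, τ)`. -/
abbrev L2 (c : ℕ) (h mu nu : ℝ) : Type := UniformSpace.Completion (PreL2 c h mu nu)

/-- The Hilbert space `L²(𝒜^∞_ħ, τ) ⊗ ℂ²`. -/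
abbrev Spinors (c : ℕ) (h mu nu : ℝ) : Type := PiLp 2 fun _ : Fin 2 => L2 c h mu nu

variable {c : ℕ} {h mu nu : ℝ}

/-- Left multiplication on the pre-Hilbert space. -/
def preLeftMul (a : SmoothAlgebra c h mu nu) : PreL2 c h mu nu →L[ℂ] PreL2 c h mu nu :=
  LinearMap.mkContinuousOfExistsBound
    (toPreL2.toLinearMap ∘ₗ LinearMap.mulLeft ℂ a ∘ₗ toPreL2.symm.toLinearMap) (by
      obtain ⟨C, hC0, hC⟩ := SmoothAlgebra.normSq_mul_le a
      refine ⟨C, fun u => ?_⟩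
      have hn : ∀ v : SmoothAlgebra c h mu nu,
          ENNReal.ofReal (‖toPreL2 v‖ ^ 2) = SmoothAlgebra.normSq v := fun v => by
        rw [← SmoothAlgebra.ofReal_re_trace_star_mul_self, @norm_sq_eq_re_inner ℂ, inner_toPreL2]
        rfl
      obtain ⟨u, rfl⟩ := toPreL2.surjective u
      have h1 := hC u
      rw [← hn, ← hn, ← ENNReal.ofReal_mul hC0, ← ENNReal.ofReal_mul (mul_nonneg hC0 hC0),
        ENNReal.ofReal_le_ofReal_iff (by positivity)] at h1
      refine le_of_sq_le_sq ?_ (by positivity)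
      change ‖toPreL2 (a * u)‖ ^ 2 ≤ _
      calc _ ≤ _ := h1
        _ = _ := by ring)

theorem preLeftMul_apply (a u : SmoothAlgebra c h mu nu) :
    preLeftMul a (toPreL2 u) = toPreL2 (a * u) := rfl

/-- The image of an element of the algebra in `L²`. -/
def toL2 : SmoothAlgebra c h mu nu →ₗ[ℂ] L2 c h mu nu :=
  (UniformSpace.Completion.toComplₗᵢ : PreL2 c h mu nu →ₗᵢ[ℂ] L2 c h mu nu).toLinearMap ∘ₗ
    toPreL2.toLinearMap

theorem toL2_injective : Function.Injective (toL2 : SmoothAlgebra c h mu nu → L2 c h mu nu) :=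
  (UniformSpace.Completion.coe_injective (PreL2 c h mu nu)).comp toPreL2.injective

theorem denseRange_toL2 : DenseRange (toL2 : SmoothAlgebra c h mu nu → L2 c h mu nu) := by
  have h1 : (toL2 : SmoothAlgebra c h mu nu → L2 c h mu nu) =
      (fun x : PreL2 c h mu nu => (x : L2 c h mu nu)) ∘ toPreL2 := rfl
  rw [h1]
  exact UniformSpace.Completion.denseRange_coe.comp toPreL2.surjective.denseRange
    (UniformSpace.Completion.continuous_coe _)

theorem inner_toL2 (a b : SmoothAlgebra c h mu nu) :
    inner ℂ (toL2 a) (toL2 b) = SmoothAlgebra.trace (star a * b) := by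
  rw [← inner_toPreL2]
  exact UniformSpace.Completion.inner_coe _ _

/-- The representation of the algebra on `L²` by left multiplication. -/
def leftMul (a : SmoothAlgebra c h mu nu) : L2 c h mu nu →L[ℂ] L2 c h mu nu :=
  (preLeftMul a).completion

theorem leftMul_apply (a u : SmoothAlgebra c h mu nu) : leftMul a (toL2 u) = toL2 (a * u) :=
  ContinuousLinearMap.completion_apply_coe _ _

theorem clm_ext_toL2 {S S' : L2 c h mu nu →L[ℂ] L2 c h mu nu}
    (hS : ∀ u : SmoothAlgebra c h mu nu, S (toL2 u) = S' (toL2 u)) : S = S' :=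
  ContinuousLinearMap.ext fun x => congrFun (denseRange_toL2.equalizer S.continuous
    S'.continuous (funext hS)) x

/-- `leftMul` as a `*`-homomorphism. -/
def leftRep : SmoothAlgebra c h mu nu →⋆ₐ[ℂ] (L2 c h mu nu →L[ℂ] L2 c h mu nu) where
  toFun := leftMul
  map_one' := clm_ext_toL2 fun u => by rw [leftMul_apply, one_mul]; rfl
  map_mul' a b := clm_ext_toL2 fun u => by
    change _ = leftMul a (leftMul b (toL2 u))
    rw [leftMul_apply, leftMul_apply, leftMul_apply, mul_assoc]
  map_zero' := clm_ext_toL2 fun u => by rw [leftMul_apply, zero_mul, map_zero]; rfl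
  map_add' a b := clm_ext_toL2 fun u => by
    rw [leftMul_apply, add_mul, map_add, add_apply, leftMul_apply, leftMul_apply]
  commutes' r := clm_ext_toL2 fun u => by
    rw [leftMul_apply, ← Algebra.smul_def, map_smul]; rfl
  map_star' a := by
    rw [ContinuousLinearMap.star_eq_adjoint]
    refine clm_ext_toL2 fun u => ?_
    have h1 : (fun x : L2 c h mu nu => inner ℂ (leftMul (star a) (toL2 u)) x) =
        fun x => inner ℂ (ContinuousLinearMap.adjoint (leftMul a) (toL2 u)) x := by
      refine denseRange_toL2.equalizer (by fun_prop) (by fun_prop) (funext fun v => ?_)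
      simp only [Function.comp_apply]
      rw [ContinuousLinearMap.adjoint_inner_left, leftMul_apply, leftMul_apply, inner_toL2,
        inner_toL2, star_mul, star_star, mul_assoc]
    exact ext_inner_right ℂ (congrFun h1)


variable {c : ℕ} {h mu nu : ℝ}

namespace SmoothAlgebra

theorem partialDeriv_star (a : SmoothAlgebra c h mu nu) (v : ℝ × ℝ) (p : ℤ) (z : ℝ × ℝ) :
    partialDeriv v (star a).fn p z = (starRingEnd ℂ) (partialDeriv v a.fn (-p) z) := by
  have h1 := Complex.conjCLE.toContinuousLinearMap.hasFDerivAt.comp z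
    (a.isSmoothSection.differentiable (-p) z).hasFDerivAt
  have h2 : fderiv ℝ ((star a).fn p) z = _ := h1.fderiv
  simp only [partialDeriv, h2]
  rfl

theorem d_star (alpha : ℝ) (j : Fin 3) (a : SmoothAlgebra c h mu nu) :
    d alpha j (star a) = star (d alpha j a) := by
  refine ext fun p z => ?_
  fin_cases j
  · change d1Fun (star a).fn p z = (starRingEnd ℂ) (d1Fun a.fn (-p) z)
    simp only [d1Fun, partialDeriv_star, map_neg]
  · change d2Fun c (star a).fn p z = (starRingEnd ℂ) (d2Fun c a.fn (-p) z)
    simp only [d2Fun, partialDeriv_star]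
    simp only [map_sub, map_mul, fn_star, starConj, Complex.conj_I,
      Complex.conj_ofReal, map_ofNat, map_natCast, map_intCast]
    push_cast
    ring
  · change d3Fun c alpha (star a).fn p z = (starRingEnd ℂ) (d3Fun c alpha a.fn (-p) z)
    simp only [d3Fun, map_mul, fn_star, starConj, Complex.conj_I,
      Complex.conj_ofReal, map_ofNat, map_natCast, map_intCast]
    push_cast
    ring

theorem delta_star (alpha : ℝ) (j : Fin 3) (a : SmoothAlgebra c h mu nu) :
    delta alpha j (star a) = -star (delta alpha j a) := by
  simp only [delta, LinearMap.smul_apply, d_star, star_smul, Complex.star_def, Complex.conj_I,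
    neg_smul, neg_neg]

theorem fn_add_one_fst_zero (a : SmoothAlgebra c h mu nu) (x y : ℝ) :
    a.fn 0 (x + 1, y) = a.fn 0 (x, y) := by
  have := a.isSmoothSection.quasiperiodic 1 0 x y
  simpa [e] using this

theorem trace_partialDeriv (a : SmoothAlgebra c h mu nu) :
    (∫ z in unitSquare, partialDeriv (1, 0) a.fn 0 z) = 0 ∧
      (∫ z in unitSquare, partialDeriv (0, 1) a.fn 0 z) = 0 := by
  have hd : ∀ z, HasFDerivAt (a.fn 0) (fderiv ℝ (a.fn 0) z) z := fun z =>
    (a.isSmoothSection.differentiable 0 z).hasFDerivAt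
  have hc : ∀ v, Continuous (partialDeriv v a.fn 0) := fun v =>
    (partialDeriv_smooth a.isSmoothSection v 0).continuous
  have hi : ∀ v, MeasureTheory.Integrable (partialDeriv v a.fn 0)
      ((MeasureTheory.volume.restrict (Set.Ioc (0 : ℝ) 1)).prod
        (MeasureTheory.volume.restrict (Set.Ioc (0 : ℝ) 1))) := fun v => by
    rw [MeasureTheory.Measure.prod_restrict, ← MeasureTheory.Measure.volume_eq_prod]
    exact ((hc v).continuousOn.integrableOn_compact (K := Set.Icc 0 1 ×ˢ Set.Icc 0 1)
      (isCompact_Icc.prod isCompact_Icc)).mono_set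
      (Set.prod_mono Set.Ioc_subset_Icc_self Set.Ioc_subset_Icc_self)
  have hx : ∀ y, ∫ x in Set.Ioc (0 : ℝ) 1, partialDeriv (1, 0) a.fn 0 (x, y) = 0 := fun y => by
    rw [← intervalIntegral.integral_of_le zero_le_one,
      intervalIntegral.integral_eq_sub_of_hasDerivAt (f := fun x => a.fn 0 (x, y))
        (f' := fun x => partialDeriv (1, 0) a.fn 0 (x, y)) (fun x _ => ?_) (Continuous.intervalIntegrable ((hc (1, 0)).comp (by fun_prop)) _ _)]
    · have := fn_add_one_fst_zero a 0 y
      rw [zero_add] at this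
      rw [this, sub_self]
    · exact (hd (x, y)).comp_hasDerivAt x ((hasDerivAt_id x).prodMk (hasDerivAt_const x y))
  have hy : ∀ x, ∫ y in Set.Ioc (0 : ℝ) 1, partialDeriv (0, 1) a.fn 0 (x, y) = 0 := fun x => by
    rw [← intervalIntegral.integral_of_le zero_le_one,
      intervalIntegral.integral_eq_sub_of_hasDerivAt (f := fun y => a.fn 0 (x, y))
        (f' := fun y => partialDeriv (0, 1) a.fn 0 (x, y)) (fun y _ => ?_) (Continuous.intervalIntegrable ((hc (0, 1)).comp (by fun_prop)) _ _)]
    · have := a.isSmoothSection.periodic 0 x 0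
      rw [zero_add] at this
      rw [this, sub_self]
    · exact (hd (x, y)).comp_hasDerivAt y ((hasDerivAt_const y x).prodMk (hasDerivAt_id y))
  unfold unitSquare
  rw [MeasureTheory.Measure.volume_eq_prod, ← MeasureTheory.Measure.prod_restrict]
  constructor
  · rw [MeasureTheory.integral_prod_symm _ (hi _)]
    simp [hx]
  · rw [MeasureTheory.integral_prod _ (hi _)]
    simp [hy]

theorem trace_delta (alpha : ℝ) (j : Fin 3) (a : SmoothAlgebra c h mu nu) :
    trace (delta alpha j a) = 0 := by
  have h1 : trace (d alpha j a) = 0 := by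
    fin_cases j
    · change ∫ z in unitSquare, d1Fun a.fn 0 z = 0
      simp only [d1Fun, MeasureTheory.integral_neg, (trace_partialDeriv a).1, neg_zero]
    · change ∫ z in unitSquare, d2Fun c a.fn 0 z = 0
      simp [d2Fun, MeasureTheory.integral_neg, (trace_partialDeriv a).2]
    · change ∫ z in unitSquare, d3Fun c alpha a.fn 0 z = 0
      simp [d3Fun]
  rw [delta, LinearMap.smul_apply, trace_smul, h1, mul_zero]

theorem trace_delta_symm (alpha : ℝ) (j : Fin 3) (a b : SmoothAlgebra c h mu nu) :
    trace (star (delta alpha j a) * b) = trace (star a * delta alpha j b) := by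
  have h1 := trace_delta alpha j (star a * b)
  rw [delta_mul, delta_star, neg_mul, trace_add] at h1
  have h2 : trace (-(star (delta alpha j a) * b)) = -trace (star (delta alpha j a) * b) := by
    rw [← neg_one_smul ℂ, trace_smul, neg_one_mul]
  rw [h2] at h1
  linear_combination -h1

end SmoothAlgebra

/-- The matrices `σ₁, σ₂, σ₃` (indexed by `0, 1, 2`). -/
def sigma : Fin 3 → Matrix (Fin 2) (Fin 2) ℂ :=
  ![!![1, 0; 0, -1], !![0, -1; -1, 0], !![0, Complex.I; -Complex.I, 0]]

theorem sigma_star (j : Fin 3) (i k : Fin 2) :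
    (starRingEnd ℂ) (sigma j i k) = sigma j k i := by
  fin_cases j <;> fin_cases i <;> fin_cases k <;> simp [sigma]

/-- The operator on `L² ⊗ ℂ²` given by a `2 × 2` matrix of operators on `L²`. -/
def matrixOp (M : Matrix (Fin 2) (Fin 2) (L2 c h mu nu →L[ℂ] L2 c h mu nu)) :
    Spinors c h mu nu →L[ℂ] Spinors c h mu nu :=
  (PiLp.continuousLinearEquiv 2 ℂ fun _ : Fin 2 => L2 c h mu nu).symm.toContinuousLinearMap ∘L
    ContinuousLinearMap.pi fun i => ∑ k, M i k ∘L PiLp.proj 2 (fun _ : Fin 2 => L2 c h mu nu) k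

theorem matrixOp_apply (M : Matrix (Fin 2) (Fin 2) (L2 c h mu nu →L[ℂ] L2 c h mu nu))
    (psi : Spinors c h mu nu) (i : Fin 2) : matrixOp M psi i = ∑ k, M i k (psi k) := by
  simp [matrixOp]

/-- The operator `1 ⊗ σ_j` on `L² ⊗ ℂ²`. -/
def sigmaOp (j : Fin 3) : Spinors c h mu nu →L[ℂ] Spinors c h mu nu :=
  matrixOp <| Matrix.of fun i k => sigma j i k • ContinuousLinearMap.id ℂ (L2 c h mu nu)

/-- The diagonal action of an operator on `L²` on `L² ⊗ ℂ²`. -/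
def diagOp (S : L2 c h mu nu →L[ℂ] L2 c h mu nu) : Spinors c h mu nu →L[ℂ] Spinors c h mu nu :=
  matrixOp (Matrix.diagonal fun _ => S)

theorem diagOp_apply (S : L2 c h mu nu →L[ℂ] L2 c h mu nu) (psi : Spinors c h mu nu)
    (i : Fin 2) : diagOp S psi i = S (psi i) := by
  rw [diagOp, matrixOp_apply, Finset.sum_eq_single i]
  · rw [Matrix.diagonal_apply_eq]
  · intro k _ hk
    rw [Matrix.diagonal_apply_ne _ hk.symm]; rfl
  · simp

/-- The representation `a ↦ a ⊗ 1` of the algebra on `L² ⊗ ℂ²`. -/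
def spinorRep : SmoothAlgebra c h mu nu →⋆ₐ[ℂ] (Spinors c h mu nu →L[ℂ] Spinors c h mu nu) where
  toFun a := diagOp (leftRep a)
  map_one' := by ext psi i; rw [diagOp_apply, map_one]; rfl
  map_mul' a b := by
    ext psi i
    change _ = diagOp (leftRep a) (diagOp (leftRep b) psi) i
    rw [diagOp_apply, diagOp_apply, diagOp_apply, map_mul]; rfl
  map_zero' := by ext psi i; rw [diagOp_apply, map_zero]; rfl
  map_add' a b := by
    ext psi i
    change _ = diagOp (leftRep a) psi i + diagOp (leftRep b) psi i
    rw [diagOp_apply, diagOp_apply, diagOp_apply, map_add]; rfl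
  commutes' r := by ext psi i; rw [diagOp_apply, AlgHomClass.commutes]; rfl
  map_star' a := by
    rw [ContinuousLinearMap.star_eq_adjoint, ContinuousLinearMap.eq_adjoint_iff]
    intro psi phi
    simp only [PiLp.inner_apply, diagOp_apply]
    refine Finset.sum_congr rfl fun i _ => ?_
    rw [map_star, ContinuousLinearMap.star_eq_adjoint, ContinuousLinearMap.adjoint_inner_left]

theorem spinorRep_apply (a : SmoothAlgebra c h mu nu) (psi : Spinors c h mu nu) (i : Fin 2) :
    spinorRep a psi i = leftRep a (psi i) := diagOp_apply _ _ _

/-- The embedding of `𝒜^∞_ħ ⊗ ℂ²` in `L² ⊗ ℂ²`. -/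
def spinorEmb : (Fin 2 → SmoothAlgebra c h mu nu) →ₗ[ℂ] Spinors c h mu nu where
  toFun u := WithLp.toLp 2 fun i => toL2 (u i)
  map_add' u v := by ext i; simp
  map_smul' r u := by ext i; simp

theorem spinorEmb_apply (u : Fin 2 → SmoothAlgebra c h mu nu) (i : Fin 2) :
    spinorEmb u i = toL2 (u i) := rfl

theorem spinorEmb_injective :
    Function.Injective (spinorEmb : (Fin 2 → SmoothAlgebra c h mu nu) → Spinors c h mu nu) :=
  fun _ _ huv => funext fun i => toL2_injective (congrArg (fun psi : Spinors c h mu nu => psi i) huv)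

theorem denseRange_spinorEmb :
    DenseRange (spinorEmb : (Fin 2 → SmoothAlgebra c h mu nu) → Spinors c h mu nu) := by
  have h1 : DenseRange (Pi.map fun _ : Fin 2 => (toL2 : SmoothAlgebra c h mu nu → L2 c h mu nu)) :=
    DenseRange.piMap fun _ => denseRange_toL2
  exact (PiLp.homeomorph 2 fun _ : Fin 2 => L2 c h mu nu).symm.surjective.denseRange.comp h1
    (PiLp.homeomorph 2 fun _ : Fin 2 => L2 c h mu nu).symm.continuous

/-- The Dirac operator `∑_j δ_j ⊗ σ_j` on `𝒜^∞_ħ ⊗ ℂ²`. -/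
def diracCore (alpha : ℝ) :
    (Fin 2 → SmoothAlgebra c h mu nu) →ₗ[ℂ] (Fin 2 → SmoothAlgebra c h mu nu) :=
  LinearMap.pi fun i => ∑ k, ∑ j, sigma j i k • SmoothAlgebra.delta alpha j ∘ₗ LinearMap.proj k

theorem diracCore_apply (alpha : ℝ) (u : Fin 2 → SmoothAlgebra c h mu nu) (i : Fin 2) :
    diracCore alpha u i = ∑ k, ∑ j, sigma j i k • SmoothAlgebra.delta alpha j (u k) := by
  simp [diracCore]

/-- The Dirac operator `D = ∑_j δ_j ⊗ σ_j`, as an operator on `L² ⊗ ℂ²` with the dense domain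
`𝒜^∞_ħ ⊗ ℂ²`. -/
def dirac (alpha : ℝ) : Spinors c h mu nu →ₗ.[ℂ] Spinors c h mu nu where
  domain := LinearMap.range spinorEmb
  toFun := spinorEmb ∘ₗ diracCore alpha ∘ₗ
    (LinearEquiv.ofInjective spinorEmb spinorEmb_injective).symm.toLinearMap

theorem dirac_apply (alpha : ℝ)
    (x : (dirac (c := c) (h := h) (mu := mu) (nu := nu) alpha).domain)
    (u : Fin 2 → SmoothAlgebra c h mu nu) (hu : (x : Spinors c h mu nu) = spinorEmb u) :
    dirac alpha x = spinorEmb (diracCore alpha u) := by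
  have h1 : (LinearEquiv.ofInjective (spinorEmb (c := c) (h := h) (mu := mu) (nu := nu))
      spinorEmb_injective).symm x = u :=
    (LinearEquiv.symm_apply_eq _).mpr (Subtype.ext hu)
  change spinorEmb (diracCore alpha ((LinearEquiv.ofInjective spinorEmb
    spinorEmb_injective).symm x)) = _
  rw [h1]

theorem spinorRep_emb (a : SmoothAlgebra c h mu nu) (u : Fin 2 → SmoothAlgebra c h mu nu) :
    spinorRep a (spinorEmb u) = spinorEmb fun i => a * u i := by
  ext i
  rw [spinorRep_apply, spinorEmb_apply, spinorEmb_apply]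
  exact leftMul_apply _ _

/-- The spectral triple of the quantum Heisenberg manifold: the algebra `𝒜^∞_ħ` acting by left
multiplication on `L²(𝒜^∞_ħ, τ) ⊗ ℂ²`, with `D = ∑_j δ_j ⊗ σ_j` on the core `𝒜^∞_ħ ⊗ ℂ²`. -/
def triple (c : ℕ) (h mu nu alpha : ℝ) :
    DiracTriple (SmoothAlgebra c h mu nu) (Spinors c h mu nu) where
  rep := spinorRep
  rep_injective a b hab := by
    have h1 := congrArg (fun S : Spinors c h mu nu →L[ℂ] Spinors c h mu nu =>
      S (spinorEmb fun _ => 1)) hab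
    simp only [spinorRep_emb, mul_one] at h1
    exact congrFun (spinorEmb_injective h1) 0
  D := dirac alpha
  dense_domain := denseRange_spinorEmb
  symmetric := by
    intro x y
    obtain ⟨u, hu⟩ := x.2
    obtain ⟨v, hv⟩ := y.2
    rw [dirac_apply alpha x u hu.symm, dirac_apply alpha y v hv.symm, ← hu, ← hv]
    simp only [PiLp.inner_apply, spinorEmb_apply, diracCore_apply, inner_toL2,
      map_sum, map_smul, sum_inner, inner_sum, inner_smul_left, inner_smul_right,
      SmoothAlgebra.trace_delta_symm, sigma_star]
    rw [Finset.sum_comm]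
  rep_mem_domain a := by
    rintro _ ⟨u, rfl⟩
    exact ⟨_, (spinorRep_emb a u).symm⟩
  exists_commutator a := by
    refine ⟨matrixOp (Matrix.of fun i k =>
      leftRep (∑ j, sigma j i k • SmoothAlgebra.delta alpha j a)), ?_⟩
    intro x
    obtain ⟨u, hu⟩ := x.2
    have h1 := dirac_apply alpha x u hu.symm
    have h2 : spinorRep a (x : Spinors c h mu nu) = spinorEmb fun i => a * u i := by
      rw [← hu, spinorRep_emb]
    rw [h1, dirac_apply alpha _ _ h2, spinorRep_emb, ← hu]
    ext i
    rw [matrixOp_apply, PiLp.sub_apply, spinorEmb_apply, spinorEmb_apply, ← map_sub]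
    simp only [spinorEmb_apply, Matrix.of_apply]
    have h3 : ∀ b w : SmoothAlgebra c h mu nu, leftRep b (toL2 w) = toL2 (b * w) :=
      fun b w => leftMul_apply b w
    simp only [h3]
    rw [← map_sum]
    congr 1
    simp only [diracCore_apply, Finset.sum_mul, Finset.mul_sum, ← Finset.sum_sub_distrib,
      SmoothAlgebra.delta_mul, smul_add, smul_mul_assoc, mul_smul_comm, add_sub_cancel_right]

end QHM

end

/-! The three operators `1 ⊗ σ_j` form a basis of `Ω¹_D` that is central and self-adjoint, and
everything follows from this. By the Leibniz rule for `δ_j`, `[D, a] = ∑ δ_j(a) σ_j`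
(`comm_triple`). The `σ_j` commute with the algebra, are self-adjoint, and are linearly independent
even over the algebra (`spinorRep_sigmaOp_coeff_unique`). Once they are known to be one-forms, every
one-form is uniquely `∑ a_j σ_j`. These facts are collected in `CentralFrame`.

Given such a frame `θ_j`, coefficients can be moved across the tensor sign, so `(ξ_j) ↦ ∑ ξ_j ⊗ θ_j`
is onto `ℰ ⊗ Ω¹_D`. It is injective because pairing with `ξ_j` recovers `⟨ξ_j, ξ_j⟩` as a
coefficient, and the inner product is definite. A linear map `ℰ → ℰ ⊗ Ω¹_D` is therefore the same as
a family of linear maps `N_j : ℰ → ℰ`. Comparing coefficients turns the Leibniz rule and the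
compatibility condition into the corresponding conditions on each `N_j` (`leibniz_iff`,
`compatible_iff`). Centrality is what lets the right action and the adjoint be computed
coefficientwise.

The analytic content is that `1 ⊗ σ_j` really lies in `Ω¹_D`. For the first two, the unitaries `u =
e(x)` and `u = e(y)` have degree `p = 0` and each is moved by only one derivation, so `u^* [D, u]`
equals `2π σ₁`, respectively `2π σ₂`. The derivation `δ₃` multiplies the degree `p` component by
`-2πpcα`, so the third operator needs elements of nonzero degree. Degree one elements are sections
of a line bundle of degree `c > 0` over the torus, and none of them is nowhere zero. However, two of
them, `b₀` and `b₁`, can be chosen without common zeros, and then `∑ a_i b_i = 1` is solvable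
(`exists_degreeOne_frame`). In `∑ a_i [D, b_i]` the coefficient of `σ₃` is the nonzero scalar
`-2πcα`, and the other two terms are already one-forms and can be subtracted. -/

noncomputable section

/-! ### Connections over a calculus of one-forms with a central self-adjoint frame -/

namespace DiracTriple

variable {A H : Type*} [Ring A] [StarRing A] [Algebra ℂ A]
  [NormedAddCommGroup H] [InnerProductSpace ℂ H] [CompleteSpace H] (T : DiracTriple A H)
  {ι : Type*} [Fintype ι]

/-- A finite self-adjoint frame of one-forms commuting with the algebra: every commutator is
`[D, a] = ∑ δ_j(a) θ_j`, and the coefficients of a combination `∑ a_j θ_j` are unique. -/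
structure CentralFrame (delta : ι → A →ₗ[ℂ] A) (theta : ι → T.oneForms) : Prop where
  comm_eq : ∀ a, T.comm a = ∑ j, T.rep (delta j a) * (theta j : H →L[ℂ] H)
  commute : ∀ a j, T.rep a * (theta j : H →L[ℂ] H) = (theta j : H →L[ℂ] H) * T.rep a
  selfAdjoint : ∀ j, star (theta j : H →L[ℂ] H) = theta j
  coeff_unique : ∀ a b : ι → A, ∑ j, T.rep (a j) * (theta j : H →L[ℂ] H) =
    ∑ j, T.rep (b j) * (theta j : H →L[ℂ] H) → a = b

variable (E : Type*) [AddCommGroup E] [Module ℂ E] [Module Aᵐᵒᵖ E]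

/-- The map `(ξ_j) ↦ ∑ ξ_j ⊗ θ_j`. -/
def frameMap (theta : ι → T.oneForms) : (ι → E) →ₗ[ℂ] T.FormTensor E :=
  ∑ j, T.tensorRight (theta j) ∘ₗ LinearMap.proj j

variable {T E} {delta : ι → A →ₗ[ℂ] A} {theta : ι → T.oneForms}

theorem frameMap_apply (ξ : ι → E) :
    T.frameMap E theta ξ = ∑ j, T.tensorRight (theta j) (ξ j) := by
  simp [frameMap]

/-- The balancing relation itself: this is how coefficients of one-forms are absorbed into the
module. -/
theorem tensorRight_smul (a : A) (θ : T.oneForms) (ξ : E) :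
    T.tensorRight θ (MulOpposite.op a • ξ) = T.tensorRight (T.lmul a θ) ξ :=
  (Submodule.Quotient.eq _).mpr (Submodule.subset_span ⟨ξ, a, θ, rfl⟩)

theorem tensorRight_sum {κ : Type*} (s : Finset κ) (θ : κ → T.oneForms) (ξ : E) :
    T.tensorRight (∑ k ∈ s, θ k) ξ = ∑ k ∈ s, T.tensorRight (θ k) ξ := by
  simp [tensorRight, map_sum]

namespace CentralFrame

variable (hF : T.CentralFrame delta theta)
include hF

theorem diff_eq (a : A) : T.diff a = ∑ j, T.lmul (delta j a) (theta j) :=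
  Subtype.ext (by
    rw [Submodule.coe_sum]
    exact hF.comm_eq a)

/-- Centrality of the frame in the form used on the tensor product: a right factor `a` becomes a
left one and can then be moved onto `ξ`. -/
theorem rmul_eq (a : A) (j : ι) : T.rmul a (theta j) = T.lmul a (theta j) :=
  Subtype.ext (hF.commute a j).symm

/-- The generators `x [D, y]` have coefficients `x δ_j(y)`, and combinations of the frame are closed
under linear operations. The frame thus generates the one-forms as a left module. -/
theorem exists_coeff (θ : T.oneForms) : ∃ a : ι → A, θ = ∑ j, T.lmul (a j) (theta j) := by
  obtain ⟨S, hS⟩ := θ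
  -- The claim is moved from the subtype to operators so that induction over the span applies.
  suffices h1 : ∃ a : ι → A, S = ∑ j, T.rep (a j) * (theta j : H →L[ℂ] H) by
    obtain ⟨a, ha⟩ := h1
    refine ⟨a, Subtype.ext ?_⟩
    rw [Submodule.coe_sum]
    exact ha
  induction hS using Submodule.span_induction with
  | mem S hS =>
    obtain ⟨x, y, rfl⟩ := hS
    exact ⟨fun j => x * delta j y, by simp [hF.comm_eq, Finset.mul_sum, mul_assoc]⟩
  | zero => exact ⟨0, by simp⟩
  | add S S' _ _ h1 h2 =>
    obtain ⟨a, rfl⟩ := h1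
    obtain ⟨b, rfl⟩ := h2
    exact ⟨a + b, by simp [add_mul, Finset.sum_add_distrib]⟩
  | smul r S _ h1 =>
    obtain ⟨a, rfl⟩ := h1
    exact ⟨r • a, by simp [Finset.smul_sum]⟩

/-- On elementary tensors, `ξ ⊗ ∑ a_j θ_j = ∑ ξ a_j ⊗ θ_j`; the range is a subspace, so this
suffices. -/
theorem frameMap_surjective : Function.Surjective (T.frameMap E theta) := by
  rw [← LinearMap.range_eq_top, eq_top_iff]
  rintro t -
  obtain ⟨t, rfl⟩ := Submodule.Quotient.mk_surjective _ t
  induction t using TensorProduct.induction_on with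
  | zero => exact zero_mem _
  | add s t hs ht => exact add_mem hs ht
  | tmul ξ θ =>
    obtain ⟨a, rfl⟩ := hF.exists_coeff θ
    refine ⟨fun j => MulOpposite.op (a j) • ξ, ?_⟩
    simp only [frameMap_apply, tensorRight_smul]
    rw [← tensorRight_sum]
    rfl

variable [IsScalarTower ℂ Aᵐᵒᵖ E] (herm : T.HermitianStructure E)

omit hF in
theorem pairRight_frameMap (η : E) (ξ : ι → E) : herm.pairRight η (T.frameMap E theta ξ) =
    ∑ j, T.rep (herm.inner η (ξ j)) * (theta j : H →L[ℂ] H) := by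
  simp only [frameMap_apply, map_sum, HermitianStructure.pairRight_tensorRight]

/-- The adjoint of `⟨η, ξ_j⟩ θ_j` is `θ_j^* ⟨ξ_j, η⟩`. Self-adjointness removes the star and
centrality brings the coefficient back to the left, where it can be compared with that of
`pairRight`. -/
theorem pairLeft_frameMap (ξ : ι → E) (η : E) : herm.pairLeft (T.frameMap E theta ξ) η =
    ∑ j, T.rep (herm.inner (ξ j) η) * (theta j : H →L[ℂ] H) := by
  rw [HermitianStructure.pairLeft, pairRight_frameMap, star_sum]
  refine Finset.sum_congr rfl fun j _ => ?_
  rw [star_mul, ← map_star, herm.star_inner, hF.selfAdjoint, hF.commute]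

include herm in
-- The Hermitian structure detects vanishing in the tensor product: a zero tensor pairs to zero with
-- every module element, and unique coefficients then give `⟨η, ξ_k⟩ = 0` for all `η` and `k`.
theorem frameMap_injective : Function.Injective (T.frameMap E theta) := by
  rw [injective_iff_map_eq_zero]
  intro ξ hξ
  ext j
  refine herm.definite _ ?_
  -- Pairing with `ξ j` itself makes the `j`-th coefficient equal to `⟨ξ_j, ξ_j⟩`, so that
  -- definiteness applies.
  have h1 := pairRight_frameMap (theta := theta) herm (ξ j) ξ
  rw [hξ, map_zero] at h1
  refine congrFun (hF.coeff_unique (fun k => herm.inner (ξ j) (ξ k)) 0 ?_) j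
  rw [← h1]
  simp

include herm in
-- Both terms on the right of the Leibniz rule lie in the image of one coefficient family: `(N_j ξ ⊗
-- θ_j) a = (N_j ξ) a ⊗ θ_j` by centrality, and `ξ ⊗ da = ∑ ξ δ_j(a) ⊗ θ_j`. Injectivity of
-- `frameMap` then allows comparison term by term.
theorem leibniz_iff (N : ι → E →ₗ[ℂ] E) (ξ : E) (a : A) :
    T.frameMap E theta (fun j => N j (MulOpposite.op a • ξ)) =
      T.rightMul E a (T.frameMap E theta fun j => N j ξ) + T.tensorRight (T.diff a) ξ ↔
    ∀ j, N j (MulOpposite.op a • ξ) =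
      MulOpposite.op a • N j ξ + MulOpposite.op (delta j a) • ξ := by
  have h1 : T.rightMul E a (T.frameMap E theta fun j => N j ξ) + T.tensorRight (T.diff a) ξ =
      T.frameMap E theta fun j => MulOpposite.op a • N j ξ + MulOpposite.op (delta j a) • ξ := by
    rw [hF.diff_eq, tensorRight_sum]
    simp only [frameMap_apply, map_sum, map_add, rightMul_tensorRight, hF.rmul_eq,
      tensorRight_smul, Finset.sum_add_distrib]
  rw [h1, (hF.frameMap_injective herm).eq_iff, funext_iff]

/-- Both sides are combinations `∑ a_j θ_j` of operators, so the single identity splits into one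
identity for each `j` by uniqueness of the coefficients. -/
theorem compatible_iff (N : ι → E →ₗ[ℂ] E) (ξ η : E) :
    herm.pairRight ξ (T.frameMap E theta fun j => N j η) -
      herm.pairLeft (T.frameMap E theta fun j => N j ξ) η =
        (T.diff (herm.inner ξ η) : H →L[ℂ] H) ↔
    ∀ j, delta j (herm.inner ξ η) = herm.inner ξ (N j η) - herm.inner (N j ξ) η := by
  rw [pairRight_frameMap, hF.pairLeft_frameMap, ← Finset.sum_sub_distrib]
  simp only [← sub_mul, ← map_sub]
  change _ = T.comm _ ↔ _
  rw [hF.comm_eq]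
  constructor
  · intro h1 j
    exact (congrFun (hF.coeff_unique (fun j => herm.inner ξ (N j η) - herm.inner (N j ξ) η)
      (fun j => delta j (herm.inner ξ η)) h1) j).symm
  · intro h1
    exact Finset.sum_congr rfl fun j _ => by rw [h1]

/-- Compatible connections correspond to families of compatible covariant derivatives. -/
theorem bijOn_compatibleConnections :
    Set.BijOn (fun N : ι → E →ₗ[ℂ] E => ∑ j, T.tensorRight (theta j) ∘ₗ N j)
      {N | ∀ j,
        (∀ (ξ : E) (a : A), N j (MulOpposite.op a • ξ) =
          MulOpposite.op a • N j ξ + MulOpposite.op (delta j a) • ξ) ∧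
        ∀ ξ ξ' : E, delta j (herm.inner ξ ξ') =
          herm.inner ξ (N j ξ') - herm.inner (N j ξ) ξ'}
      {nabla | herm.IsCompatibleConnection nabla} := by
  have happ : ∀ (N : ι → E →ₗ[ℂ] E) (ξ : E), (∑ j, T.tensorRight (theta j) ∘ₗ N j) ξ =
      T.frameMap E theta fun j => N j ξ := fun N ξ => by simp [frameMap_apply]
  -- This equivalence yields both that the map lands in the compatible connections and, read
  -- backwards, that the components of a compatible connection satisfy the required conditions.
  have hiff : ∀ N : ι → E →ₗ[ℂ] E,
      herm.IsCompatibleConnection (∑ j, T.tensorRight (theta j) ∘ₗ N j) ↔ ∀ j,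
        (∀ (ξ : E) (a : A), N j (MulOpposite.op a • ξ) =
          MulOpposite.op a • N j ξ + MulOpposite.op (delta j a) • ξ) ∧
        ∀ ξ ξ' : E, delta j (herm.inner ξ ξ') =
          herm.inner ξ (N j ξ') - herm.inner (N j ξ) ξ' := by
    intro N
    constructor
    · rintro ⟨h1, h2⟩ j
      simp only [happ, hF.leibniz_iff herm] at h1
      simp only [happ, hF.compatible_iff herm] at h2
      exact ⟨fun ξ a => h1 ξ a j, fun ξ η => h2 ξ η j⟩
    · intro h1
      constructor
      · simp only [happ, hF.leibniz_iff herm]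
        exact fun ξ a j => (h1 j).1 ξ a
      · simp only [happ, hF.compatible_iff herm]
        exact fun ξ η j => (h1 j).2 ξ η
  refine ⟨fun N hN => (hiff N).mpr hN, fun N _ N' _ hNN => ?_, fun nabla hnabla => ?_⟩
  · funext j
    ext ξ
    have h1 := LinearMap.congr_fun hNN ξ
    simp only [happ] at h1
    exact congrFun (hF.frameMap_injective herm h1) j
  · let equiv := LinearEquiv.ofBijective (T.frameMap E theta)
      ⟨hF.frameMap_injective herm, hF.frameMap_surjective⟩
    -- The components of `nabla` are its coordinates under the frame isomorphism; they are linear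
    -- because its inverse is.
    let N : ι → E →ₗ[ℂ] E := fun j => LinearMap.proj j ∘ₗ equiv.symm.toLinearMap ∘ₗ nabla
    have h1 : ∑ j, T.tensorRight (theta j) ∘ₗ N j = nabla :=
      LinearMap.ext fun ξ => (happ N ξ).trans (equiv.apply_symm_apply (nabla ξ))
    exact ⟨N, (hiff N).mp (h1.symm ▸ hnabla), h1⟩

end CentralFrame

end DiracTriple

end

noncomputable section

/-! ### Homogeneous elements of the algebra and the unitaries `e(x)`, `e(y)` -/

namespace QHM

theorem e_int (n : ℤ) : e n = 1 := by
  unfold e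
  rw [← Complex.exp_int_mul_two_pi_mul_I n]
  push_cast
  ring_nf

theorem deriv_e (t : ℝ) : deriv e t = ((2 * Real.pi : ℝ) * Complex.I) * e t := by
  have h1 := congrFun (e_iteratedDeriv 1) t
  rwa [iteratedDeriv_one, pow_one] at h1

theorem differentiable_e : Differentiable ℝ e := e_contDiff.differentiable (by simp)

/-- Sections supported in a single degree `n`. -/
theorem isSmoothSection_single {c : ℕ} (n : ℤ) {g : ℝ × ℝ → ℂ} (hg : ContDiff ℝ ∞ g)
    (hper : ∀ x y, g (x, y + 1) = g (x, y))
    (hquasi : ∀ (k : ℤ) (x y : ℝ), g (x + k, y) = e (c * k * n * y) * g (x, y)) :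
    IsSmoothSection c (Pi.single n g) where
  smooth p := by
    rcases eq_or_ne p n with rfl | hp
    · simpa using hg
    · rw [Pi.single_eq_of_ne hp]
      exact contDiff_const
  periodic p x y := by
    rcases eq_or_ne p n with rfl | hp
    · simpa using hper x y
    · simp [Pi.single_eq_of_ne hp]
  quasiperiodic k p x y := by
    rcases eq_or_ne p n with rfl | hp
    · simpa using hquasi k x y
    · simp [Pi.single_eq_of_ne hp]
  decay N k K hK := by
    obtain ⟨C, hC⟩ := hK.exists_bound_of_continuousOn
      (hg.continuous_iteratedFDeriv (m := k) (by exact_mod_cast le_top)).continuousOn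
    -- Rapid decay is automatic, since only `p = n` contributes; the `0` in the maximum covers all
    -- other degrees, and also the case of empty `K`, where `C` may be negative.
    refine ⟨max 0 (|(n : ℝ)| ^ N * C), fun p z hz => ?_⟩
    rcases eq_or_ne p n with rfl | hp
    · rw [Pi.single_eq_same]
      refine le_trans ?_ (le_max_right _ _)
      gcongr
      exact hC z hz
    · have h0 : iteratedFDeriv ℝ k ((Pi.single n g : ℤ → ℝ × ℝ → ℂ) p) z = 0 := by
        rw [Pi.single_eq_of_ne hp]
        simp
      rw [h0, norm_zero, mul_zero]
      exact le_max_left _ _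

namespace SmoothAlgebra

variable {c : ℕ} {h mu nu : ℝ}

/-- The product series collapses to the single term `q = m`, which is nonzero only for `p = m + n`.
Then `q - p = -n`, which explains the plus sign in the argument of `f`. -/
theorem fn_mul_single {a b : SmoothAlgebra c h mu nu} {m n : ℤ} {f g : ℝ × ℝ → ℂ}
    (ha : a.fn = Pi.single m f) (hb : b.fn = Pi.single n g) :
    (a * b).fn = Pi.single (m + n)
      fun z => f (z + step h mu nu n) * g (z - step h mu nu m) := by
  funext p z
  rw [fn_mul, starMul, tsum_eq_single m fun q hq => by
    rw [mulTerm, ha, Pi.single_eq_of_ne hq, Pi.zero_apply, zero_mul], mulTerm, ha, hb,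
    Pi.single_eq_same]
  rcases eq_or_ne p (m + n) with rfl | hp
  · rw [Pi.single_eq_same, show m + n - m = n by ring, Pi.single_eq_same,
      show m - (m + n) = -n by ring, step_neg, sub_neg_eq_add]
  · rw [Pi.single_eq_of_ne hp, Pi.single_eq_of_ne (by omega : p - m ≠ n), Pi.zero_apply, mul_zero,
      Pi.zero_apply]

theorem fn_star_single {a : SmoothAlgebra c h mu nu} {n : ℤ} {f : ℝ × ℝ → ℂ}
    (ha : a.fn = Pi.single n f) :
    (star a).fn = Pi.single (-n) fun z => (starRingEnd ℂ) (f z) := by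
  funext p z
  rw [fn_star, starConj, ha]
  rcases eq_or_ne p (-n) with rfl | hp
  · simp
  · rw [Pi.single_eq_of_ne hp, Pi.single_eq_of_ne (by omega : -p ≠ n)]
    simp

theorem fn_one_single : (1 : SmoothAlgebra c h mu nu).fn = Pi.single 0 fun _ => 1 := by
  funext p z
  rcases eq_or_ne p 0 with rfl | hp
  · simp [fn_one, starOne]
  · simp [fn_one, starOne, hp]

/-- The unitary `e(x)`. -/
def unitaryX (c : ℕ) (h mu nu : ℝ) : SmoothAlgebra c h mu nu :=
  mk (Pi.single 0 fun z => e z.1) <| isSmoothSection_single 0 (e_contDiff.comp contDiff_fst)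
    (fun _ _ => rfl) fun k x y => by
      -- In degree zero the quasiperiodicity factor is trivial, so genuine periodicity in `x` is
      -- required; `e(k) = 1` provides it.
      rw [e_add, e_int, mul_one]
      simp [e]

/-- The unitary `e(y)`. -/
def unitaryY (c : ℕ) (h mu nu : ℝ) : SmoothAlgebra c h mu nu :=
  mk (Pi.single 0 fun z => e z.2) <| isSmoothSection_single 0 (e_contDiff.comp contDiff_snd)
    (fun x y => by
      have h1 := e_int 1
      rw [Int.cast_one] at h1
      simp [e_add, h1]) fun k x y => by simp [e]

/-- In degree zero no translation occurs and the product is pointwise. -/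
theorem star_mul_self_eq_one {a : SmoothAlgebra c h mu nu} {f : ℝ × ℝ → ℂ}
    (ha : a.fn = Pi.single 0 f) (hf : ∀ z, ‖f z‖ = 1) : star a * a = 1 := by
  apply fn_injective
  rw [fn_mul_single (fn_star_single ha) ha, fn_one_single, neg_zero, add_zero, step_zero]
  congr 1
  funext z
  rw [add_zero, sub_zero, ← Complex.normSq_eq_conj_mul_self, Complex.normSq_eq_norm_sq, hf]
  simp

theorem fn_delta_zero (alpha : ℝ) (a : SmoothAlgebra c h mu nu) (p : ℤ) (z : ℝ × ℝ) :
    (delta alpha 0 a).fn p z = Complex.I * -(fderiv ℝ (a.fn p) z (1, 0)) := rfl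

theorem fn_delta_one (alpha : ℝ) (a : SmoothAlgebra c h mu nu) (p : ℤ) (z : ℝ × ℝ) :
    (delta alpha 1 a).fn p z = Complex.I * (2 * Real.pi * Complex.I * c * p * z.1 * a.fn p z -
      fderiv ℝ (a.fn p) z (0, 1)) := rfl

theorem fn_delta_two (alpha : ℝ) (a : SmoothAlgebra c h mu nu) (p : ℤ) (z : ℝ × ℝ) :
    (delta alpha 2 a).fn p z =
      Complex.I * (2 * Real.pi * Complex.I * p * c * alpha * a.fn p z) := rfl

/-- Homogeneous elements are eigenvectors of the third derivation, which is a multiple of the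
degree; the sign is `i · i = -1`. -/
theorem delta_two_single {alpha : ℝ} {a : SmoothAlgebra c h mu nu} {n : ℤ} {f : ℝ × ℝ → ℂ}
    (ha : a.fn = Pi.single n f) :
    delta alpha 2 a = (-(2 * Real.pi * n * c * alpha) : ℂ) • a := by
  refine ext fun p z => ?_
  rw [fn_delta_two, fn_smul, ha]
  rcases eq_or_ne p n with rfl | hp
  · rw [Pi.smul_apply, Pi.smul_apply, Pi.single_eq_same, smul_eq_mul]
    linear_combination (2 * Real.pi * p * c * alpha * f z : ℂ) * Complex.I_mul_I
  · rw [Pi.smul_apply, Pi.smul_apply, Pi.single_eq_of_ne hp]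
    simp

theorem fderiv_e_comp (L : ℝ × ℝ →L[ℝ] ℝ) (z v : ℝ × ℝ) :
    fderiv ℝ (fun z => e (L z)) z v = L v * (((2 * Real.pi : ℝ) * Complex.I) * e (L z)) := by
  have h1 := (differentiable_e (L z)).hasDerivAt.hasFDerivAt.comp z L.hasFDerivAt
  rw [deriv_e] at h1
  have h2 := congrArg (fun S => S v) h1.fderiv
  simpa [Function.comp_def] using h2

/-- Since `e(x)` has degree zero, the terms with a factor `p` disappear and only `-i ∂_x` acts; the
eigenvalue is `-i · 2πi = 2π`. -/
theorem delta_unitaryX (alpha : ℝ) (j : Fin 3) : delta alpha j (unitaryX c h mu nu) =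
    if j = 0 then (2 * Real.pi : ℂ) • unitaryX c h mu nu else 0 := by
  have h2 := fderiv_e_comp (ContinuousLinearMap.fst ℝ ℝ ℝ)
  simp only [ContinuousLinearMap.coe_fst'] at h2
  refine ext fun p z => ?_
  fin_cases j
  · simp only [Fin.zero_eta, Fin.isValue, if_true]
    rw [fn_delta_zero, fn_smul, unitaryX, fn_mk, Pi.smul_apply, Pi.smul_apply]
    rcases eq_or_ne p 0 with rfl | hp
    · rw [Pi.single_eq_same, h2, smul_eq_mul]
      push_cast
      linear_combination (-2 * Real.pi * e z.1 : ℂ) * Complex.I_mul_I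
    · rw [Pi.single_eq_of_ne hp]
      simp
  · simp only [Fin.mk_one, Fin.isValue, one_ne_zero, if_false]
    rw [fn_delta_one, unitaryX, fn_mk]
    rcases eq_or_ne p 0 with rfl | hp
    · rw [Pi.single_eq_same, h2]
      simp
    · rw [Pi.single_eq_of_ne hp]
      simp
  · change (delta alpha 2 (unitaryX c h mu nu)).fn p z = 0
    rw [delta_two_single (n := 0) (f := fun z => e z.1) rfl]
    simp

/-- As for `e(x)`, now with `-i ∂_y` as the only derivation that acts. -/
theorem delta_unitaryY (alpha : ℝ) (j : Fin 3) : delta alpha j (unitaryY c h mu nu) =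
    if j = 1 then (2 * Real.pi : ℂ) • unitaryY c h mu nu else 0 := by
  have h2 := fderiv_e_comp (ContinuousLinearMap.snd ℝ ℝ ℝ)
  simp only [ContinuousLinearMap.coe_snd'] at h2
  refine ext fun p z => ?_
  fin_cases j
  · simp only [Fin.zero_eta, Fin.isValue, zero_ne_one, if_false]
    rw [fn_delta_zero, unitaryY, fn_mk]
    rcases eq_or_ne p 0 with rfl | hp
    · rw [Pi.single_eq_same, h2]
      simp
    · rw [Pi.single_eq_of_ne hp]
      simp
  · simp only [Fin.mk_one, Fin.isValue, if_true]
    rw [fn_delta_one, fn_smul, unitaryY, fn_mk, Pi.smul_apply, Pi.smul_apply]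
    rcases eq_or_ne p 0 with rfl | hp
    · rw [Pi.single_eq_same, h2, smul_eq_mul]
      push_cast
      linear_combination (-2 * Real.pi * e z.2 : ℂ) * Complex.I_mul_I
    · rw [Pi.single_eq_of_ne hp]
      simp
  · change (delta alpha 2 (unitaryY c h mu nu)).fn p z = 0
    rw [delta_two_single (n := 0) (f := fun z => e z.2) rfl]
    simp

end SmoothAlgebra

/-! ### A frame of two elements of degree one -/

/-- A smooth bump supported in `(1/8, 7/8)` and equal to `1` on `[1/4, 3/4]`. -/
def unitBump : ContDiffBump (1 / 2 : ℝ) := ⟨1 / 4, 3 / 8, by norm_num, by norm_num⟩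

theorem unitBump_eq_zero_iff (x : ℝ) : unitBump x = 0 ↔ x ≤ 1 / 8 ∨ 7 / 8 ≤ x := by
  rw [← Function.notMem_support, unitBump.support_eq, Metric.mem_ball, Real.dist_eq, abs_lt]
  change ¬ (-(3 / 8) < x - 1 / 2 ∧ x - 1 / 2 < 3 / 8) ↔ _
  rw [not_and_or, not_lt, not_lt]
  constructor <;> rintro (h1 | h1) <;> first | (left; linarith) | (right; linarith)

/-- A smooth section of degree one whose zeros are near the lines `x ∈ ℤ`. -/
def bumpSection (c : ℕ) (z : ℝ × ℝ) : ℂ := e (c * ⌊z.1⌋ * z.2) * unitBump (Int.fract z.1)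

/-- The floor may be frozen at `m` even slightly outside `[m, m + 1)`: within `1/8` of an integer
the bump vanishes, so the jump of the phase there is invisible. The enlarged strips are open and
cover the plane, which makes the section smooth. -/
theorem bumpSection_eq {c : ℕ} {m : ℤ} {z : ℝ × ℝ} (h1 : (m : ℝ) - 1 / 8 < z.1)
    (h2 : z.1 < m + 1 + 1 / 8) : bumpSection c z = e (c * m * z.2) * unitBump (z.1 - m) := by
  by_cases h3 : z.1 < m
  · have h4 : ⌊z.1⌋ = m - 1 := by
      rw [Int.floor_eq_iff]
      push_cast
      constructor <;> linarith
    -- Just left of `m` both sides are zero: `z.1 - m` is negative, and the fractional part exceeds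
    -- `7/8`.
    rw [bumpSection, (unitBump_eq_zero_iff (z.1 - m)).mpr (Or.inl (by linarith)),
      (unitBump_eq_zero_iff (Int.fract z.1)).mpr (Or.inr ?_)]
    · simp
    · rw [Int.fract, h4]
      push_cast
      linarith
  by_cases h5 : z.1 < m + 1
  · have h4 : ⌊z.1⌋ = m := Int.floor_eq_iff.mpr ⟨not_lt.mp h3, h5⟩
    rw [bumpSection, Int.fract, h4]
  · have h4 : ⌊z.1⌋ = m + 1 := by
      rw [Int.floor_eq_iff]
      push_cast
      constructor <;> linarith
    -- On the other margin both sides vanish again: `z.1 - m` is at least `1`, and the fractional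
    -- part is below `1/8`.
    rw [bumpSection, (unitBump_eq_zero_iff (z.1 - m)).mpr (Or.inr (by linarith)),
      (unitBump_eq_zero_iff (Int.fract z.1)).mpr (Or.inl ?_)]
    · simp
    · rw [Int.fract, h4]
      push_cast
      linarith

theorem contDiff_bumpSection (c : ℕ) : ContDiff ℝ ∞ (bumpSection c) := by
  rw [contDiff_iff_contDiffAt]
  intro z
  have h1 : bumpSection c =ᶠ[nhds z]
      fun w => e (c * ⌊z.1⌋ * w.2) * unitBump (w.1 - ⌊z.1⌋) := by
    have h2 : ∀ᶠ w : ℝ × ℝ in nhds z, w.1 ∈ Set.Ioo ((⌊z.1⌋ : ℝ) - 1 / 8) (⌊z.1⌋ + 1 + 1 / 8) :=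
      continuous_fst.continuousAt.eventually (Ioo_mem_nhds
        (by linarith [Int.floor_le z.1]) (by linarith [Int.lt_floor_add_one z.1]))
    filter_upwards [h2] with w hw
    exact bumpSection_eq hw.1 hw.2
  refine ContDiffAt.congr_of_eventuallyEq (ContDiff.contDiffAt ?_) h1
  refine (contDiff_e_mul _).mul (Complex.ofRealCLM.contDiff.comp ?_)
  exact unitBump.contDiff.comp (by fun_prop)

theorem bumpSection_add_one (c : ℕ) (x y : ℝ) :
    bumpSection c (x, y + 1) = bumpSection c (x, y) := by
  -- Periodicity in `y` holds because `c * ⌊x⌋` is an integer.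
  have h1 : (c * ⌊x⌋ * (y + 1) : ℝ) = c * ⌊x⌋ * y + ((c * ⌊x⌋ : ℤ) : ℝ) := by
    push_cast
    ring
  simp only [bumpSection]
  rw [h1, e_add, e_int, mul_one]

/-- The floor in the phase is chosen for this: shifting `x` by `k` changes the phase by exactly the
factor prescribed in degree one and leaves the bump unchanged. -/
theorem bumpSection_add_int (c : ℕ) (k : ℤ) (x y : ℝ) :
    bumpSection c (x + k, y) = e (c * k * y) * bumpSection c (x, y) := by
  simp only [bumpSection, Int.floor_add_intCast, Int.fract_add_intCast]
  rw [← mul_assoc, ← e_add]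
  congr 2
  push_cast
  ring

/-- The section vanishes only for `x` within `1/8` of an integer, and its translate only for `x`
within `1/8` of a half-integer; these sets are disjoint. -/
theorem bumpSection_ne_zero (c : ℕ) (z : ℝ × ℝ) :
    bumpSection c z ≠ 0 ∨ bumpSection c (z + (1 / 2, 0)) ≠ 0 := by
  by_contra! h1
  have he : ∀ t, e t ≠ 0 := fun t => norm_ne_zero_iff.mp (by rw [norm_e]; exact one_ne_zero)
  have h0 : ∀ w, bumpSection c w = 0 → Int.fract w.1 ≤ 1 / 8 ∨ 7 / 8 ≤ Int.fract w.1 :=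
    fun w hw => by
      rw [← unitBump_eq_zero_iff]
      exact_mod_cast (mul_eq_zero.mp hw).resolve_left (he _)
  have h2 := h0 _ h1.1
  have h3 := h0 _ h1.2
  have h4 := Int.fract_nonneg z.1
  have h5 := Int.fract_lt_one z.1
  -- This reduces to the fractional part `t` of `z.1`. For `t ≤ 1/8` the translate has fractional
  -- part `t + 1/2`, and for `t ≥ 7/8` it has `t - 1/2`; both lie strictly between `1/8` and `7/8`.
  have h6 : z.1 + 1 / 2 = (Int.fract z.1 + 1 / 2) + (⌊z.1⌋ : ℝ) := by rw [Int.fract]; ring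
  rw [Prod.fst_add, h6, Int.fract_add_intCast] at h3
  rcases h2 with h2 | h2
  · rw [Int.fract_eq_self.mpr ⟨by linarith, by linarith⟩] at h3
    rcases h3 with h3 | h3 <;> linarith
  · have h7 : Int.fract (Int.fract z.1 + 1 / 2) = Int.fract z.1 - 1 / 2 := by
      rw [Int.fract_eq_iff]
      exact ⟨by linarith, by linarith, 1, by push_cast; ring⟩
    rw [h7] at h3
    rcases h3 with h3 | h3 <;> linarith

namespace SmoothAlgebra

variable (c : ℕ) (h mu nu : ℝ)

/-- The elements of degree one given by `bumpSection` and its translate by `1/2`. -/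
def degreeOne (i : Fin 2) : SmoothAlgebra c h mu nu :=
  mk (Pi.single 1 fun z => bumpSection c (z + ((i : ℝ) / 2, 0))) <| isSmoothSection_single 1
    ((contDiff_bumpSection c).comp (by fun_prop))
    (fun x y => by
      have h1 := bumpSection_add_one c (x + (i : ℝ) / 2) y
      simpa using h1)
    fun k x y => by
      have h1 := bumpSection_add_int c k (x + (i : ℝ) / 2) y
      rw [add_right_comm] at h1
      simpa using h1

/-- The degree one component contains a frame: `∑ a_i b_i = 1` with `b_i` of degree one. -/
theorem exists_degreeOne_frame : ∃ a : Fin 2 → SmoothAlgebra c h mu nu,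
    ∑ i, a i * degreeOne c h mu nu i = 1 := by
  set v := step h mu nu 1 with hv
  let w : Fin 2 → ℝ × ℝ := fun i => ((i : ℝ) / 2, 0)
  -- `G` is the degree zero function `∑ b_i^* b_i`; the shift by `v` is the translation that the
  -- twisted product introduces.
  let G : ℝ × ℝ → ℝ := fun z => ∑ i, ‖bumpSection c (z + v + w i)‖ ^ 2
  have hG0 : ∀ z, G z ≠ 0 := by
    intro z hz
    rw [Finset.sum_eq_zero_iff_of_nonneg fun i _ => by positivity] at hz
    have h1 := hz 0 (Finset.mem_univ _)
    have h2 := hz 1 (Finset.mem_univ _)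
    rcases bumpSection_ne_zero c (z + v) with h3 | h3
    · refine h3 ?_
      have h4 : w 0 = 0 := by simp [w]
      simpa [h4] using h1
    · refine h3 ?_
      have h4 : w 1 = (1 / 2, 0) := by simp [w]
      rw [h4] at h2
      simpa using h2
  have hG : ContDiff ℝ ∞ G := by
    refine ContDiff.sum fun i _ => ContDiff.norm_sq ℝ ?_
    exact (contDiff_bumpSection c).comp (by fun_prop)
  -- `G` has no zeros and is periodic in both variables, since the quasiperiodicity phases have
  -- modulus one. Its inverse is therefore an element of degree zero.
  have hr : IsSmoothSection c (Pi.single 0 fun z => ((G z)⁻¹ : ℂ)) := by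
    refine isSmoothSection_single 0 ?_ (fun x y => ?_) fun k x y => ?_
    · have h1 : ContDiff ℝ ∞ fun z => (G z)⁻¹ := hG.inv hG0
      have h2 := Complex.ofRealCLM.contDiff.comp h1
      simpa [Function.comp_def] using h2
    · have h1 : G (x, y + 1) = G (x, y) := by
        refine Finset.sum_congr rfl fun i _ => ?_
        have h2 := bumpSection_add_one c (x + v.1 + (w i).1) (y + v.2 + (w i).2)
        rw [show ((x, y + 1) + v + w i : ℝ × ℝ) =
            (x + v.1 + (w i).1, y + v.2 + (w i).2 + 1) by ext <;> simp <;> ring, h2]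
        rfl
      rw [h1]
    · have h1 : G (x + k, y) = G (x, y) := by
        refine Finset.sum_congr rfl fun i _ => ?_
        have h2 := bumpSection_add_int c k (x + v.1 + (w i).1) (y + v.2 + (w i).2)
        rw [show ((x + k, y) + v + w i : ℝ × ℝ) =
            (x + v.1 + (w i).1 + k, y + v.2 + (w i).2) by ext <;> simp <;> ring, h2, norm_mul,
          norm_e, one_mul]
        rfl
      rw [h1]
      simp [e]
  -- With `a_i = G⁻¹ b_i^*` the sum becomes `G⁻¹ G`, a product in degree zero and hence pointwise.
  refine ⟨fun i => mk _ hr * star (degreeOne c h mu nu i), ?_⟩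
  simp only [mul_assoc]
  rw [← Finset.mul_sum]
  have hs : (∑ i, star (degreeOne c h mu nu i) * degreeOne c h mu nu i).fn =
      Pi.single 0 fun z => (G z : ℂ) := by
    have h1 : ∀ i, (star (degreeOne c h mu nu i) * degreeOne c h mu nu i).fn =
        Pi.single 0 fun z => ((‖bumpSection c (z + v + w i)‖ ^ 2 : ℝ) : ℂ) := by
      intro i
      have hd : ∀ i, (degreeOne c h mu nu i).fn =
          Pi.single 1 fun z => bumpSection c (z + w i) := fun _ => rfl
      rw [fn_mul_single (fn_star_single (hd i)) (hd i), step_neg, neg_add_cancel]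
      congr 1
      funext z
      rw [sub_neg_eq_add, ← Complex.normSq_eq_conj_mul_self, Complex.normSq_eq_norm_sq]
    rw [Fin.sum_univ_two, fn_add, h1, h1, ← Pi.single_add]
    congr 1
    funext z
    simp [G]
  apply fn_injective
  rw [fn_mul_single (fn_mk _ _) hs, fn_one_single, add_zero, step_zero]
  congr 1
  funext z
  rw [add_zero, sub_zero]
  exact inv_mul_cancel₀ (by exact_mod_cast hG0 z)

end SmoothAlgebra

end QHM

end

noncomputable section

/-! ### The operators `1 ⊗ σ_j` as a central frame of one-forms -/

namespace QHM

variable {c : ℕ} {h mu nu : ℝ}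

theorem sigmaOp_apply (j : Fin 3) (psi : Spinors c h mu nu) (i : Fin 2) :
    sigmaOp j psi i = ∑ k, sigma j i k • psi k := by
  rw [sigmaOp, matrixOp_apply]
  rfl

theorem star_sigmaOp (j : Fin 3) :
    star (sigmaOp j : Spinors c h mu nu →L[ℂ] Spinors c h mu nu) = sigmaOp j := by
  rw [ContinuousLinearMap.star_eq_adjoint]
  refine (ContinuousLinearMap.eq_adjoint_iff _ _).mpr (fun psi phi => ?_) |>.symm
  simp only [PiLp.inner_apply, sigmaOp_apply, sum_inner, inner_sum, inner_smul_left,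
    inner_smul_right, sigma_star]
  exact Finset.sum_comm

theorem spinorRep_mul_sigmaOp (a : SmoothAlgebra c h mu nu) (j : Fin 3) :
    spinorRep a * sigmaOp j = sigmaOp j * spinorRep a := by
  ext psi i
  change spinorRep a (sigmaOp j psi) i = sigmaOp j (spinorRep a psi) i
  simp only [spinorRep_apply, sigmaOp_apply, map_sum, map_smul]

/-- On the core, `∑ a_j σ_j` acts as a `2 × 2` matrix with entries in the algebra. This turns
identities between such operators into identities in the algebra. -/
theorem sum_spinorRep_mul_sigmaOp_emb (a : Fin 3 → SmoothAlgebra c h mu nu)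
    (u : Fin 2 → SmoothAlgebra c h mu nu) :
    (∑ j, spinorRep (a j) * sigmaOp j : Spinors c h mu nu →L[ℂ] Spinors c h mu nu)
        (spinorEmb u) =
      spinorEmb fun i => ∑ k, ∑ j, sigma j i k • (a j * u k) := by
  have h1 : ∀ j, sigmaOp j (spinorEmb u) = spinorEmb fun i => ∑ k, sigma j i k • u k := by
    intro j
    ext i
    rw [sigmaOp_apply]
    simp only [spinorEmb_apply, map_sum, map_smul]
  rw [sum_apply]
  change ∑ j, spinorRep (a j) (sigmaOp j (spinorEmb u)) = _
  simp_rw [h1, spinorRep_emb]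
  rw [← map_sum]
  congr 1
  funext i
  rw [Finset.sum_apply, Finset.sum_comm]
  simp_rw [Finset.mul_sum, mul_smul_comm]

/-- The matrix entries of `∑ a_j σ_j` can be read off in the algebra, since it embeds injectively in
`L²`; linear independence of the three matrices then recovers the coefficients. -/
theorem spinorRep_sigmaOp_coeff_unique (a b : Fin 3 → SmoothAlgebra c h mu nu)
    (hab : ∑ j, spinorRep (a j) * sigmaOp j = ∑ j, spinorRep (b j) * sigmaOp j) : a = b := by
  have h1 : ∀ i k, ∑ j, sigma j i k • a j = ∑ j, sigma j i k • b j := by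
    intro i k
    -- Evaluation at `1 ⊗ e_k` extracts the `k`-th column.
    have h2 := congrArg (fun S : Spinors c h mu nu →L[ℂ] Spinors c h mu nu =>
      S (spinorEmb (Pi.single k 1))) hab
    simp only [sum_spinorRep_mul_sigmaOp_emb] at h2
    have h3 := congrFun (spinorEmb_injective h2) i
    have h4 : ∀ a : Fin 3 → SmoothAlgebra c h mu nu,
        ∑ l, ∑ j, sigma j i l • (a j * (Pi.single k 1 : Fin 2 → SmoothAlgebra c h mu nu) l) =
          ∑ j, sigma j i k • a j := fun a => by
      rw [Finset.sum_eq_single k (fun l _ hl => by simp [Pi.single_eq_of_ne hl]) (by simp)]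
      simp
    rwa [h4, h4] at h3
  have h00 := h1 0 0
  have h01 := h1 0 1
  have h10 := h1 1 0
  -- With coefficients numbered from zero, the three entries are `a₀`, `-a₁ + i a₂` and `-a₁ - i
  -- a₂`; `hneg` solves the last two for `a₁` and `a₂`.
  simp [sigma, Fin.sum_univ_three] at h00 h01 h10
  have hneg : ∀ x y z w : SmoothAlgebra c h mu nu, -x + Complex.I • y = -z + Complex.I • w →
      -x + -(Complex.I • y) = -z + -(Complex.I • w) → x = z ∧ y = w := by
    intro x y z w e1 e2
    have e3 : (2 : ℂ) • x = (2 : ℂ) • z := by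
      rw [two_smul, two_smul]
      have := congrArg₂ (· + ·) e1 e2
      rw [← neg_inj]
      calc -(x + x) = -x + Complex.I • y + (-x + -(Complex.I • y)) := by abel
        _ = _ := this
        _ = _ := by abel
    have e4 : x = z := smul_right_injective _ two_ne_zero e3
    subst e4
    exact ⟨rfl, smul_right_injective _ Complex.I_ne_zero (add_left_cancel e1)⟩
  obtain ⟨h5, h6⟩ := hneg _ _ _ _ h01 h10
  funext j
  fin_cases j
  exacts [h00, h5, h6]

variable (c h mu nu) (alpha : ℝ)

/-- On the core, the Leibniz rule for `δ_j` leaves only the term in which `a` is differentiated;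
bounded operators agreeing on a dense domain are equal. -/
theorem comm_triple (a : SmoothAlgebra c h mu nu) : (triple c h mu nu alpha).comm a =
    ∑ j, spinorRep (SmoothAlgebra.delta alpha j a) * sigmaOp j := by
  refine (triple c h mu nu alpha).ext_domain fun x => ?_
  obtain ⟨u, hu⟩ := x.2
  have h2 : spinorRep a (x : Spinors c h mu nu) = spinorEmb fun i => a * u i := by
    rw [← hu, spinorRep_emb]
  rw [(triple c h mu nu alpha).comm_apply]
  change dirac alpha ⟨spinorRep a x, _⟩ - spinorRep a (dirac alpha x) = _
  rw [dirac_apply alpha x u hu.symm, dirac_apply alpha _ _ h2, spinorRep_emb, ← hu,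
    sum_spinorRep_mul_sigmaOp_emb, ← map_sub]
  congr 1
  funext i
  simp only [Pi.sub_apply, diracCore_apply, Finset.mul_sum, ← Finset.sum_sub_distrib,
    SmoothAlgebra.delta_mul, smul_add, mul_smul_comm, add_sub_cancel_right]

/-- If `∑ a_k δ_j(b_k)` is a nonzero scalar for `j = l`, and the remaining components lie in the
one-forms, then `1 ⊗ σ_l` is a one-form. -/
theorem sigmaOp_mem_of_sum {κ : Type*} [Fintype κ] (l : Fin 3) (r : ℂ) (hr : r ≠ 0)
    (a b : κ → SmoothAlgebra c h mu nu)
    (hl : ∑ k, a k * SmoothAlgebra.delta alpha l (b k) = r • 1)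
    (hne : ∀ j, j ≠ l → spinorRep (∑ k, a k * SmoothAlgebra.delta alpha j (b k)) * sigmaOp j ∈
      (triple c h mu nu alpha).oneForms) :
    sigmaOp l ∈ (triple c h mu nu alpha).oneForms := by
  have h1 : ∑ k, spinorRep (a k) * (triple c h mu nu alpha).comm (b k) =
      ∑ j, spinorRep (∑ k, a k * SmoothAlgebra.delta alpha j (b k)) * sigmaOp j := by
    simp only [comm_triple, Finset.mul_sum, map_sum, map_mul, Finset.sum_mul, mul_assoc]
    exact Finset.sum_comm
  have h2 : ∑ k, spinorRep (a k) * (triple c h mu nu alpha).comm (b k) ∈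
      (triple c h mu nu alpha).oneForms :=
    Submodule.sum_mem _ fun k _ => Submodule.subset_span ⟨a k, b k, rfl⟩
  -- The `l`-th term of the one-form `∑ a_k [D, b_k]` is isolated as `r σ_l`; the remaining terms
  -- are one-forms by `hne`, so `r σ_l` is one too.
  rw [h1, ← Finset.add_sum_erase _ _ (Finset.mem_univ l), hl, map_smul, map_one, smul_mul_assoc,
    one_mul] at h2
  have h3 := (Submodule.add_mem_iff_left _
    (Submodule.sum_mem _ fun j hj => hne j (Finset.ne_of_mem_erase hj))).mp h2
  exact (Submodule.smul_mem_iff _ hr).mp h3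

theorem sigmaOp_mem_oneForms (hc : 0 < c) (halpha : alpha ≠ 0) (j : Fin 3) :
    sigmaOp j ∈ (triple c h mu nu alpha).oneForms := by
  have hpi : (2 * Real.pi : ℂ) ≠ 0 :=
    mul_ne_zero two_ne_zero (Complex.ofReal_ne_zero.mpr Real.pi_ne_zero)
  have h0 : sigmaOp 0 ∈ (triple c h mu nu alpha).oneForms := by
    refine sigmaOp_mem_of_sum c h mu nu alpha (κ := Unit) 0 (2 * Real.pi) hpi
      (fun _ => star (SmoothAlgebra.unitaryX c h mu nu))
      (fun _ => SmoothAlgebra.unitaryX c h mu nu) ?_ fun j hj => ?_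
    · simp only [SmoothAlgebra.delta_unitaryX, if_true, mul_smul_comm, Finset.univ_unique,
        Finset.sum_singleton]
      rw [SmoothAlgebra.star_mul_self_eq_one rfl fun z => norm_e z.1]
    · simp [SmoothAlgebra.delta_unitaryX, hj]
  have h1 : sigmaOp 1 ∈ (triple c h mu nu alpha).oneForms := by
    refine sigmaOp_mem_of_sum c h mu nu alpha (κ := Unit) 1 (2 * Real.pi) hpi
      (fun _ => star (SmoothAlgebra.unitaryY c h mu nu))
      (fun _ => SmoothAlgebra.unitaryY c h mu nu) ?_ fun j hj => ?_
    · simp only [SmoothAlgebra.delta_unitaryY, if_true, mul_smul_comm, Finset.univ_unique,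
        Finset.sum_singleton]
      rw [SmoothAlgebra.star_mul_self_eq_one rfl fun z => norm_e z.2]
    · simp [SmoothAlgebra.delta_unitaryY, hj]
  have h2 : sigmaOp 2 ∈ (triple c h mu nu alpha).oneForms := by
    obtain ⟨a, ha⟩ := SmoothAlgebra.exists_degreeOne_frame c h mu nu
    -- The scalar is the eigenvalue of the third derivation in degree `1`, with the degree kept as
    -- an integer cast to match `delta_two_single`. It is nonzero because `c` and `alpha` are.
    refine sigmaOp_mem_of_sum c h mu nu alpha 2 (-(2 * Real.pi * (1 : ℤ) * c * alpha)) ?_ a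
      (SmoothAlgebra.degreeOne c h mu nu) ?_ fun j hj => ?_
    · rw [Int.cast_one, mul_one]
      exact neg_ne_zero.mpr (mul_ne_zero (mul_ne_zero hpi (Nat.cast_ne_zero.mpr hc.ne'))
        (Complex.ofReal_ne_zero.mpr halpha))
    · have h3 : ∀ i, SmoothAlgebra.delta alpha 2 (SmoothAlgebra.degreeOne c h mu nu i) =
          (-(2 * Real.pi * (1 : ℤ) * c * alpha) : ℂ) • SmoothAlgebra.degreeOne c h mu nu i :=
        fun i => SmoothAlgebra.delta_two_single rfl
      simp only [h3, mul_smul_comm]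
      rw [← Finset.smul_sum, ha]
    -- The other two coefficients need not be computed: the first two operators are already
    -- one-forms, and one-forms are stable under left multiplication.
    · refine (triple c h mu nu alpha).rep_mul_mem _ _ ?_
      fin_cases j
      exacts [h0, h1, (hj rfl).elim]
  fin_cases j
  exacts [h0, h1, h2]

/-- The one-forms `1 ⊗ σ_j`. -/
def theta (hc : 0 < c) (halpha : alpha ≠ 0) (j : Fin 3) : (triple c h mu nu alpha).oneForms :=
  ⟨sigmaOp j, sigmaOp_mem_oneForms c h mu nu alpha hc halpha j⟩

theorem centralFrame_theta (hc : 0 < c) (halpha : alpha ≠ 0) :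
    (triple c h mu nu alpha).CentralFrame (SmoothAlgebra.delta alpha)
      (theta c h mu nu alpha hc halpha) where
  comm_eq := comm_triple c h mu nu alpha
  commute := spinorRep_mul_sigmaOp
  selfAdjoint := star_sigmaOp
  coeff_unique := spinorRep_sigmaOp_coeff_unique

end QHM

end

theorem mainTheorem3 (c : ℕ) (hc : 0 < c) (h mu nu : ℝ) (hmn : mu ^ 2 + nu ^ 2 ≠ 0)
    (alpha : ℝ) (halpha : 1 < alpha)
    {E : Type*} [AddCommGroup E] [Module ℂ E] [Module (QHM.SmoothAlgebra c h mu nu)ᵐᵒᵖ E]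
    [IsScalarTower ℂ (QHM.SmoothAlgebra c h mu nu)ᵐᵒᵖ E]
    [Module.Finite (QHM.SmoothAlgebra c h mu nu)ᵐᵒᵖ E]
    [Module.Projective (QHM.SmoothAlgebra c h mu nu)ᵐᵒᵖ E]
    (herm : (QHM.triple c h mu nu alpha).HermitianStructure E) :
    ∃ theta : Fin 3 → (QHM.triple c h mu nu alpha).oneForms,
      (∀ j, (theta j : QHM.Spinors c h mu nu →L[ℂ] QHM.Spinors c h mu nu) = QHM.sigmaOp j) ∧
      Set.BijOn
        (fun N : Fin 3 → E →ₗ[ℂ] E =>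
          ∑ j, (QHM.triple c h mu nu alpha).tensorRight (theta j) ∘ₗ N j)
        {N | ∀ j,
          (∀ (ξ : E) (a : QHM.SmoothAlgebra c h mu nu),
            N j (MulOpposite.op a • ξ) =
              MulOpposite.op a • N j ξ +
                MulOpposite.op (QHM.SmoothAlgebra.delta alpha j a) • ξ) ∧
          ∀ ξ ξ' : E,
            QHM.SmoothAlgebra.delta alpha j (herm.inner ξ ξ') =
              herm.inner ξ (N j ξ') - herm.inner (N j ξ) ξ'}
        {nabla | herm.IsCompatibleConnection nabla} := by
  exact ⟨QHM.theta c h mu nu alpha hc (by linarith), fun j => rfl,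
    (QHM.centralFrame_theta c h mu nu alpha hc (by linarith)).bijOn_compatibleConnections herm⟩
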